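/- Let $N\ge 3$ be an integer and let $p>\frac{N+2}{N-2}$, $b>0$ and $\lambda>0$ be real numbers. Suppose that the problem on a ball $$u''+\frac{N-1}{r}u'+\lambda u+u^p=0\quad (0<r<b),\qquad u'(0)=u(b)=0 \tag{B}$$ has at least one positive solution. Then there exists $a_0\in(0,b)$ such that, for every $a$ with $0<a<a_0$, the annulus problem $$u''+\frac{N-1}{r}u'+\lambda u+u^p=0\quad (a<r<b),\qquad u(a)=u(b)=0 \tag{A}$$ has at least three distinct positive solutions. Here a positive solution of (A), respectively (B), is a function that is continuous on the closed interval $[a,b]$, respectively $[0,b]$, positive and twice continuously differentiable in the open interval, and satisfies the equation in the open interval and the stated boundary conditions; $u'(0)$ denotes the one-sided derivative. -/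

import Mathlib

/-- `u` is twice continuously differentiable in the open interval `(a, b)` and satisfies there
the radial equation `u'' + ((N - 1) / r) u' + lam u + u ^ p = 0`, with `u > 0`. Since
`(a, b)` is open, `deriv` is the genuine derivative at each of its points. -/
def IsPositiveRadialOn (N : ℕ) (p lam a b : ℝ) (u : ℝ → ℝ) : Prop :=
  ContDiffOn ℝ 2 u (Set.Ioo a b) ∧
  (∀ r ∈ Set.Ioo a b, 0 < u r) ∧
  ∀ r ∈ Set.Ioo a b,
    deriv (deriv u) r + ((N : ℝ) - 1) / r * deriv u r + lam * u r + u r ^ p = 0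

/-- Positive (classical) solution of the annulus problem
`u'' + ((N - 1) / r) u' + lam u + u ^ p = 0` on `(a, b)`, `u a = u b = 0`.
Only the values of `u` on `[a, b]` matter. -/
def IsPositiveAnnulusSolution (N : ℕ) (p lam a b : ℝ) (u : ℝ → ℝ) : Prop :=
  IsPositiveRadialOn N p lam a b u ∧
  ContinuousOn u (Set.Icc a b) ∧
  u a = 0 ∧ u b = 0

/-- Positive (classical) solution of the ball problem
`u'' + ((N - 1) / r) u' + lam u + u ^ p = 0` on `(0, b)`, `u' 0 = u b = 0`,
where `u' 0` is the one-sided derivative at `0`.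
Only the values of `u` on `[0, b]` matter. -/
def IsPositiveBallSolution (N : ℕ) (p lam b : ℝ) (u : ℝ → ℝ) : Prop :=
  IsPositiveRadialOn N p lam 0 b u ∧
  ContinuousOn u (Set.Icc 0 b) ∧
  HasDerivWithinAt u 0 (Set.Icc 0 b) 0 ∧ u b = 0

/-- The annulus problem has at least `k` positive solutions, where solutions are identified
when they agree on `[a, b]`. -/
def HasAtLeastPositiveAnnulusSolutions (k N : ℕ) (p lam a b : ℝ) : Prop :=
  ∃ u : Fin k → ℝ → ℝ,
    (∀ i, IsPositiveAnnulusSolution N p lam a b (u i)) ∧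
    ∀ i j, i ≠ j → ¬ Set.EqOn (u i) (u j) (Set.Icc a b)

open Set Filter Topology
open scoped NNReal

/-! The proof shoots inwards from `b`. With dimension `m + 2` and flux `y = r ^ (m + 1) * u'`, start
at `u b = 0`, `y b = -η`. For fixed `a` the value `u a` depends continuously on `η`, each zero with
`η > 0` is a positive solution (`IsShooting.isPositiveAnnulusSolution`), and different `η` give
different solutions (`IsShooting.eta_eq`). So it suffices to find fluxes `η₂ < η₁ < η₀ < H` at which
`u a` has signs `+, -, +, -`.

The flux `η₀` of the ball solution `v` gives `+`. Very small flux gives `+` by Sturm comparison with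
`v` (`exists_forall_small_pos`), very large flux gives `-` because a large solution oscillates
(`exists_forall_large_neg`); both thresholds may depend on `a`.

The heart is `η₁`, chosen before `a`. By `exists_forall_small_not_entire`, no solution of small flux
is positive on all of `(0, b)`, singular ones included. Hence shooting with `η₁` turns negative at
some `a₁`, and then `u a < 0` for all `a < a₁` too. For the nonexistence, supercriticality makes `u
^ 2 * r ^ m` vanish at the origin; a Pohozaev identity combined with Hardy's inequality then bounds
it by `C * u ε ^ 2` with `C`, `ε` independent of `u`. This makes the inner flux of `u` at a small
radius `δ` negligible against `u ε`, whereas the Wronskian with the bounded solution `v` forces it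
to be comparable. -/

/-- The nonlinearity `lam * u + u ^ p`, extended by zero to negative arguments. -/
noncomputable def nonlin (p lam x : ℝ) : ℝ := lam * max x 0 + (max x 0) ^ p

/-- `u` solves the radial equation on `[a, b]` in dimension `m + 2`, written as a first order
system for `u` and the flux `y = r ^ (m + 1) * u'`, with data `u b = 0` and `y b = -η`. -/
structure IsShooting (m : ℕ) (p lam a b η : ℝ) (u y : ℝ → ℝ) : Prop where
  contu : ContinuousOn u (Icc a b)
  conty : ContinuousOn y (Icc a b)
  du : ∀ r ∈ Ioo a b, HasDerivAt u (y r / r ^ (m + 1)) r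
  dy : ∀ r ∈ Ioo a b, HasDerivAt y (-(r ^ (m + 1) * nonlin p lam (u r))) r
  ub : u b = 0
  yb : y b = -η

/-! ### One-variable calculus on closed intervals. -/

section Calculus

theorem monotoneOn_Icc_of_hasDerivAt_nonneg {f f' : ℝ → ℝ} {a b : ℝ}
    (hc : ContinuousOn f (Icc a b)) (hd : ∀ x ∈ Ioo a b, HasDerivAt f (f' x) x)
    (h : ∀ x ∈ Ioo a b, 0 ≤ f' x) : MonotoneOn f (Icc a b) := by
  refine monotoneOn_of_hasDerivWithinAt_nonneg (convex_Icc a b) hc (f' := f') ?_ ?_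
  · intro x hx; rw [interior_Icc] at hx; exact (hd x hx).hasDerivWithinAt
  · intro x hx; rw [interior_Icc] at hx; exact h x hx

theorem antitoneOn_Icc_of_hasDerivAt_nonpos {f f' : ℝ → ℝ} {a b : ℝ}
    (hc : ContinuousOn f (Icc a b)) (hd : ∀ x ∈ Ioo a b, HasDerivAt f (f' x) x)
    (h : ∀ x ∈ Ioo a b, f' x ≤ 0) : AntitoneOn f (Icc a b) := by
  refine antitoneOn_of_hasDerivWithinAt_nonpos (convex_Icc a b) hc (f' := f') ?_ ?_
  · intro x hx; rw [interior_Icc] at hx; exact (hd x hx).hasDerivWithinAt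
  · intro x hx; rw [interior_Icc] at hx; exact h x hx

theorem exists_sub_eq_mul_of_hasDerivAt {f f' : ℝ → ℝ} {a b : ℝ} (hab : a < b)
    (hc : ContinuousOn f (Icc a b)) (hd : ∀ x ∈ Ioo a b, HasDerivAt f (f' x) x) :
    ∃ c ∈ Ioo a b, f b - f a = f' c * (b - a) := by
  obtain ⟨c, hcm, h⟩ := exists_hasDerivAt_eq_slope f f' hab hc hd
  refine ⟨c, hcm, ?_⟩
  have : b - a ≠ 0 := by linarith
  rw [h]; field_simp

/-- Uniqueness for the backward problem needs a left derivative at the starting point `b` itself,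
where the system is not assumed; it comes from continuity of the right-hand side. -/
theorem hasDerivWithinAt_Iic_of_continuousWithinAt {f f' : ℝ → ℝ} {a b : ℝ} (hab : a < b)
    (hc : ContinuousOn f (Icc a b)) (hd : ∀ x ∈ Ioo a b, HasDerivAt f (f' x) x)
    (hc' : ContinuousOn f' (Ioc a b)) :
    HasDerivWithinAt f (f' b) (Iic b) b := by
  have hmem : Ioo a b ∈ 𝓝[<] b := Ioo_mem_nhdsLT hab
  refine hasDerivWithinAt_Iic_of_tendsto_deriv (s := Ioo a b)
    (fun x hx => (hd x hx).differentiableAt.differentiableWithinAt)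
    ((hc b ⟨hab.le, le_rfl⟩).mono Ioo_subset_Icc_self) hmem ?_
  have h1 : Tendsto f' (𝓝[Ioo a b] b) (𝓝 (f' b)) :=
    (hc' b ⟨hab, le_rfl⟩).mono Ioo_subset_Ioc_self
  rw [nhdsWithin_Ioo_eq_nhdsLT hab] at h1
  refine h1.congr' ?_
  filter_upwards [hmem] with x hx
  exact (hd x hx).deriv.symm

end Calculus

/-! ### The truncated nonlinearity. -/

section Nonlin

variable {p lam : ℝ}

theorem nonlin_nonneg (hl : 0 < lam) (x : ℝ) : 0 ≤ nonlin p lam x := by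
  have : (0:ℝ) ≤ max x 0 := le_max_right _ _
  unfold nonlin; positivity

theorem nonlin_of_pos {x : ℝ} (hx : 0 < x) : nonlin p lam x = lam * x + x ^ p := by
  unfold nonlin; rw [max_eq_left hx.le]

theorem nonlin_of_pos' {x : ℝ} (hx : 0 < x) :
    nonlin p lam x = x * (lam + x ^ (p - 1)) := by
  rw [nonlin_of_pos hx, Real.rpow_sub_one hx.ne']; field_simp

theorem nonlin_mono (hp : 1 < p) (hl : 0 < lam) : Monotone (nonlin p lam) := by
  intro x y hxy
  unfold nonlin
  have h0 : (0:ℝ) ≤ max x 0 := le_max_right _ _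
  have h1 : max x 0 ≤ max y 0 := max_le_max hxy le_rfl
  have : (0:ℝ) ≤ p := by linarith
  gcongr

theorem nonlin_continuous (hp : 1 < p) : Continuous (nonlin p lam) := by
  unfold nonlin
  have : Continuous fun x : ℝ => (max x 0) ^ p :=
    (continuous_id.max continuous_const).rpow_const (fun _ => Or.inr (by linarith))
  fun_prop

theorem nonlin_lipschitzOn (hp : 1 < p) (M : ℝ) :
    ∃ K : ℝ≥0, LipschitzOnWith K (nonlin p lam) (Icc (-M) M) := by
  have h1 : LocallyLipschitz (fun x : ℝ => lam * x + x ^ p) := by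
    have : ContDiff ℝ 1 (fun x : ℝ => x ^ p) :=
      Real.contDiff_rpow_const_of_le (by simpa using hp.le)
    have h : ContDiff ℝ 1 (fun x : ℝ => lam * x + x ^ p) :=
      (contDiff_const.mul contDiff_id).add this
    exact h.locallyLipschitz
  have h2 : LocallyLipschitz (fun x : ℝ => max x 0) :=
    (LipschitzWith.id.max_const 0).locallyLipschitz
  have h3 : LocallyLipschitz (nonlin p lam) := h1.comp h2
  exact (h3.locallyLipschitzOn (s := Icc (-M) M)).exists_lipschitzOnWith_of_compact isCompact_Icc

end Nonlin

/-! ### Existence, uniqueness and continuous dependence for the shooting problem. -/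

section Existence

variable {m : ℕ} {p lam a b η : ℝ}

/-- The free functions `g`, `h` let one estimate serve both the true system (`h = id`, for
uniqueness) and the clipped system (for existence). -/
theorem lipschitzOnWith_field {g h : ℝ → ℝ} {K : ℝ≥0} {s : Set ℝ} (n : ℕ)
    (hg : LipschitzOnWith K g s) (hh : LipschitzWith 1 h) (ha : 0 < a) {r : ℝ}
    (hr : r ∈ Icc a b) :
    LipschitzOnWith (max (1 / a ^ n) (b ^ n * K)).toNNReal
      (fun z : ℝ × ℝ => (h z.2 / r ^ n, -(r ^ n * g z.1))) (Prod.fst ⁻¹' s) := by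
  refine LipschitzOnWith.of_dist_le_mul fun x hx y hy => ?_
  have han : 0 < a ^ n := by positivity
  have hr0 : 0 < r := ha.trans_le hr.1
  have hb0 : 0 < b := hr0.trans_le hr.2
  have h1 : a ^ n ≤ r ^ n := pow_le_pow_left₀ ha.le hr.1 n
  have h2 : r ^ n ≤ b ^ n := pow_le_pow_left₀ hr0.le hr.2 n
  rw [Real.coe_toNNReal _ (le_max_of_le_left (by positivity))]
  have e1 := hh.dist_le_mul x.2 y.2
  have e2 := hg.dist_le_mul x.1 hx y.1 hy
  rw [Prod.dist_eq, Prod.dist_eq]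
  simp only [Real.dist_eq, NNReal.coe_one, one_mul] at e1 e2 ⊢
  refine max_le ?_ ?_
  · rw [← sub_div, abs_div, abs_of_pos (show (0:ℝ) < r ^ n by positivity)]
    calc |h x.2 - h y.2| / r ^ n ≤ |x.2 - y.2| / a ^ n := by gcongr
      _ = 1 / a ^ n * |x.2 - y.2| := by ring
      _ ≤ _ := by gcongr; exacts [le_max_left _ _, le_max_right _ _]
  · rw [show -(r ^ n * g x.1) - -(r ^ n * g y.1) = - (r ^ n * (g x.1 - g y.1)) by ring,
      abs_neg, abs_mul, abs_of_pos (show (0:ℝ) < r ^ n by positivity)]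
    calc r ^ n * |g x.1 - g y.1| ≤ b ^ n * (K * |x.1 - y.1|) := by gcongr
      _ = b ^ n * K * |x.1 - y.1| := by ring
      _ ≤ _ := by gcongr; exacts [le_max_right _ _, le_max_left _ _]

theorem IsShooting.mono {u y : ℝ → ℝ} (h : IsShooting m p lam a b η u y) {a' : ℝ}
    (haa : a ≤ a') : IsShooting m p lam a' b η u y :=
  ⟨h.contu.mono (Icc_subset_Icc_left haa), h.conty.mono (Icc_subset_Icc_left haa),
    fun r hr => h.du r ⟨haa.trans_lt hr.1, hr.2⟩, fun r hr => h.dy r ⟨haa.trans_lt hr.1, hr.2⟩,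
    h.ub, h.yb⟩

theorem IsShooting.hasDerivWithinAt {u y : ℝ → ℝ} (h : IsShooting m p lam a b η u y)
    (hp : 1 < p) (ha : 0 < a) {r : ℝ} (hr : r ∈ Ioc a b) :
    HasDerivWithinAt u (y r / r ^ (m + 1)) (Iic r) r ∧
      HasDerivWithinAt y (-(r ^ (m + 1) * nonlin p lam (u r))) (Iic r) r := by
  rcases hr.2.lt_or_eq with h1 | rfl
  · exact ⟨(h.du r ⟨hr.1, h1⟩).hasDerivWithinAt, (h.dy r ⟨hr.1, h1⟩).hasDerivWithinAt⟩
  · refine ⟨hasDerivWithinAt_Iic_of_continuousWithinAt hr.1 h.contu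
      (f' := fun r => y r / r ^ (m + 1)) h.du ?_,
      hasDerivWithinAt_Iic_of_continuousWithinAt hr.1 h.conty
      (f' := fun r => -(r ^ (m + 1) * nonlin p lam (u r))) h.dy ?_⟩
    · refine (h.conty.mono Ioc_subset_Icc_self).div (by fun_prop) ?_
      intro x hx; have := ha.trans hx.1; positivity
    · refine ContinuousOn.neg (ContinuousOn.mul (by fun_prop) ?_)
      exact (nonlin_continuous hp).comp_continuousOn (h.contu.mono Ioc_subset_Icc_self)

theorem IsShooting.unique {u y u' y' : ℝ → ℝ} (hp : 1 < p) (ha : 0 < a)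
    (h : IsShooting m p lam a b η u y) (h' : IsShooting m p lam a b η u' y') :
    EqOn u u' (Icc a b) ∧ EqOn y y' (Icc a b) := by
  obtain ⟨M1, hM1⟩ := isCompact_Icc.exists_bound_of_continuousOn h.contu
  obtain ⟨M2, hM2⟩ := isCompact_Icc.exists_bound_of_continuousOn h'.contu
  obtain ⟨K, hK⟩ := nonlin_lipschitzOn (lam := lam) hp (max M1 M2)
  have key : EqOn (fun r => (u r, y r)) (fun r => (u' r, y' r)) (Icc a b) := by
    refine ODE_solution_unique_of_mem_Icc_left
      (v := fun r (z : ℝ × ℝ) => (id z.2 / r ^ (m + 1), -(r ^ (m + 1) * nonlin p lam z.1)))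
      (s := fun _ => Prod.fst ⁻¹' Icc (-max M1 M2) (max M1 M2))
      (fun r hr => lipschitzOnWith_field (a := a) (b := b) (m + 1) hK LipschitzWith.id ha
        (Ioc_subset_Icc_self hr)) (h.contu.prodMk h.conty)
      (fun r hr => (h.hasDerivWithinAt hp ha hr).1.prodMk (h.hasDerivWithinAt hp ha hr).2)
      (fun r hr => ?_)
      (h'.contu.prodMk h'.conty)
      (fun r hr => (h'.hasDerivWithinAt hp ha hr).1.prodMk (h'.hasDerivWithinAt hp ha hr).2)
      (fun r hr => ?_) ?_
    · exact abs_le.1 ((hM1 r (Ioc_subset_Icc_self hr)).trans (le_max_left _ _))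
    · exact abs_le.1 ((hM2 r (Ioc_subset_Icc_self hr)).trans (le_max_right _ _))
    · simp only [h.ub, h.yb, h'.ub, h'.yb]
  exact ⟨fun r hr => congrArg Prod.fst (key hr), fun r hr => congrArg Prod.snd (key hr)⟩

/-- Clipping `u` and `y` makes the field bounded and Lipschitz, so Picard–Lindelöf reaches all of
`[a, b]` at once and gives Lipschitz dependence on the data. A priori bounds then show that the
clipping is never felt. -/
theorem exists_shooting_family (m : ℕ) (hp : 1 < p) (hl : 0 < lam) (ha : 0 < a) (hab : a < b)
    {H : ℝ} (hH : 0 < H) :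
    ∃ U Y : ℝ → ℝ → ℝ, (∀ η ∈ Icc 0 H, IsShooting m p lam a b η (U η) (Y η)) ∧
      ContinuousOn (fun η => U η a) (Icc 0 H) := by
  have hb : 0 < b := ha.trans hab
  -- A priori bounds: `y` is decreasing, so `y ≥ -H` and `u ≤ M`; then `|y'| ≤ B`, so `|y| ≤ T`.
  -- Clipping `u` below at `0` is harmless since `nonlin` ignores negative arguments.
  set M : ℝ := H / a ^ (m + 1) * (b - a) with hM
  have hM0 : 0 ≤ M := by have : 0 < b - a := by linarith
                         positivity
  set B : ℝ := b ^ (m + 1) * nonlin p lam M with hB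
  have hnM := nonlin_nonneg (p := p) hl M
  have hB0 : 0 ≤ B := by positivity
  set T : ℝ := H + B * (b - a) with hT
  have hT0 : 0 ≤ T := by have : 0 < b - a := by linarith
                         positivity
  set clM : ℝ → ℝ := fun x => max 0 (min x M) with hclM
  set clT : ℝ → ℝ := fun x => max (-T) (min x T) with hclT
  have clM_mem : ∀ x, clM x ∈ Icc 0 M := fun x =>
    ⟨le_max_left _ _, max_le hM0 (min_le_right _ _)⟩
  have clT_mem : ∀ x, clT x ∈ Icc (-T) T := fun x =>
    ⟨le_max_left _ _, max_le (by linarith) (min_le_right _ _)⟩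
  have clM_lip : LipschitzWith 1 clM := (LipschitzWith.id.min_const M).const_max 0
  have clT_lip : LipschitzWith 1 clT := (LipschitzWith.id.min_const T).const_max (-T)
  obtain ⟨K, hK⟩ := nonlin_lipschitzOn (lam := lam) hp M
  set g : ℝ → ℝ := fun x => nonlin p lam (clM x) with hg
  have hgK : LipschitzOnWith (K * 1) g univ :=
    hK.comp clM_lip.lipschitzOnWith (fun x _ => ⟨by linarith [(clM_mem x).1], (clM_mem x).2⟩)
  have hg0 : ∀ x, 0 ≤ g x := fun x => nonlin_nonneg hl _
  have hgM : ∀ x, g x ≤ nonlin p lam M := fun x => nonlin_mono hp hl (clM_mem x).2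
  set V : ℝ → ℝ × ℝ → ℝ × ℝ := fun r z => (clT z.2 / r ^ (m + 1), -(r ^ (m + 1) * g z.1)) with hV
  set L : ℝ≥0 := (max (T / a ^ (m + 1)) B).toNNReal with hL
  have hLc : (L : ℝ) = max (T / a ^ (m + 1)) B :=
    Real.coe_toNNReal _ (le_max_of_le_right hB0)
  have hba : 0 ≤ b - a := by linarith
  have hPL : IsPicardLindelof V (tmin := a) (tmax := b) ⟨b, hab.le, le_rfl⟩ (0 : ℝ × ℝ)
      (L * (b - a).toNNReal + H.toNNReal) H.toNNReal L
      (max (1 / a ^ (m + 1)) (b ^ (m + 1) * (K * 1 : ℝ≥0))).toNNReal := by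
    refine ⟨fun r hr => (lipschitzOnWith_field (m + 1) hgK clT_lip ha hr).mono
      (fun _ _ => mem_univ _), fun z _ => ?_, fun r hr z _ => ?_, ?_⟩
    · refine ContinuousOn.prodMk (continuousOn_const.div (by fun_prop) ?_) (by fun_prop)
      intro x hx; have := ha.trans_le hx.1; positivity
    · have hr0 : 0 < r := ha.trans_le hr.1
      rw [hLc, Prod.norm_def]
      refine max_le_max ?_ ?_
      · rw [Real.norm_eq_abs, abs_div, abs_of_pos (show (0:ℝ) < r ^ (m + 1) by positivity)]
        have := abs_le.2 (clT_mem z.2)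
        have h1 : a ^ (m + 1) ≤ r ^ (m + 1) := pow_le_pow_left₀ ha.le hr.1 _
        show |clT z.2| / r ^ (m + 1) ≤ T / a ^ (m + 1)
        gcongr
      · rw [Real.norm_eq_abs, abs_neg, abs_mul,
          abs_of_pos (show (0:ℝ) < r ^ (m + 1) by positivity), abs_of_nonneg (hg0 _)]
        have h2 : r ^ (m + 1) ≤ b ^ (m + 1) := pow_le_pow_left₀ hr0.le hr.2 _
        have := hgM z.1
        have := hg0 z.1
        show r ^ (m + 1) * g z.1 ≤ B
        rw [hB]; gcongr
    · simp [hba]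
  obtain ⟨α, hα, L', hα'⟩ :=
    hPL.exists_forall_mem_closedBall_eq_hasDerivWithinAt_lipschitzOnWith
  have hball : ∀ η ∈ Icc 0 H, ((0, -η) : ℝ × ℝ) ∈ Metric.closedBall (0 : ℝ × ℝ) H.toNNReal := by
    intro η hη
    rw [mem_closedBall_zero_iff, Prod.norm_def, Real.coe_toNNReal _ hH.le]
    simp [abs_of_nonneg hη.1, hη.2, hH.le]
  refine ⟨fun η r => (α (0, -η) r).1, fun η r => (α (0, -η) r).2, fun η hη => ?_, ?_⟩
  · obtain ⟨hα0, hαd⟩ := hα _ (hball η hη)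
    set u : ℝ → ℝ := fun r => (α (0, -η) r).1 with hu
    set y : ℝ → ℝ := fun r => (α (0, -η) r).2 with hy
    have hc : ContinuousOn (α (0, -η)) (Icc a b) := fun r hr => (hαd r hr).continuousWithinAt
    have hcu : ContinuousOn u (Icc a b) := continuous_fst.comp_continuousOn hc
    have hcy : ContinuousOn y (Icc a b) := continuous_snd.comp_continuousOn hc
    have hd : ∀ r ∈ Ioo a b, HasDerivAt (α (0, -η)) (V r (α (0, -η) r)) r := fun r hr =>
      (hαd r (Ioo_subset_Icc_self hr)).hasDerivAt (Icc_mem_nhds hr.1 hr.2)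
    have hdu : ∀ r ∈ Ioo a b, HasDerivAt u (clT (y r) / r ^ (m + 1)) r := fun r hr =>
      (hasFDerivAt_fst.comp_hasDerivAt r (hd r hr) :)
    have hdy : ∀ r ∈ Ioo a b, HasDerivAt y (-(r ^ (m + 1) * g (u r))) r := fun r hr =>
      (hasFDerivAt_snd.comp_hasDerivAt r (hd r hr) :)
    have hub : u b = 0 := by simp [hu, hα0]
    have hyb : y b = -η := by simp [hy, hα0]
    have hpos : ∀ r ∈ Icc a b, 0 < r := fun r hr => ha.trans_le hr.1
    have hanti : AntitoneOn y (Icc a b) := antitoneOn_Icc_of_hasDerivAt_nonpos hcy hdy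
      (fun r hr => by
        have := hpos r (Ioo_subset_Icc_self hr)
        have := hg0 (u r)
        have : 0 ≤ r ^ (m + 1) * g (u r) := by positivity
        linarith)
    have hylow : ∀ r ∈ Icc a b, -η ≤ y r := fun r hr => by
      rw [← hyb]; exact hanti hr ⟨hab.le, le_rfl⟩ hr.2
    have hyup : ∀ r ∈ Icc a b, y r ≤ T := by
      intro r hr
      rcases hr.2.lt_or_eq with h1 | rfl
      · obtain ⟨c, hcm, hce⟩ := exists_sub_eq_mul_of_hasDerivAt h1
          (hcy.mono (Icc_subset_Icc_left hr.1)) (fun x hx => hdy x ⟨hr.1.trans_lt hx.1, hx.2⟩)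
        rw [hyb] at hce
        have hc0 : 0 < c := (hpos r hr).trans hcm.1
        have h2 : c ^ (m + 1) ≤ b ^ (m + 1) := pow_le_pow_left₀ hc0.le hcm.2.le _
        have h3 : c ^ (m + 1) * g (u c) ≤ B := by
          have := hgM (u c)
          have := hg0 (u c)
          rw [hB]; gcongr
        have h4 : c ^ (m + 1) * g (u c) * (b - r) ≤ B * (b - a) :=
          mul_le_mul h3 (by linarith [hr.1]) (by linarith) hB0
        have := hη.1
        linarith
      · rw [hyb]; linarith [hη.1]
    have hclTy : ∀ r ∈ Icc a b, clT (y r) = y r := by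
      intro r hr
      have h1 := hylow r hr
      have h2 : H ≤ T := by rw [hT]; have : 0 ≤ B * (b - a) := by positivity
                            linarith
      rw [hclT]; simp only
      rw [min_eq_left (hyup r hr), max_eq_right (by linarith [hη.2])]
    have hgu : ∀ r ∈ Icc a b, g (u r) = nonlin p lam (u r) := by
      intro r hr
      have huM : u r ≤ M := by
        rcases hr.2.lt_or_eq with h1 | rfl
        · obtain ⟨c, hcm, hce⟩ := exists_sub_eq_mul_of_hasDerivAt h1
            (hcu.mono (Icc_subset_Icc_left hr.1)) (fun x hx => hdu x ⟨hr.1.trans_lt hx.1, hx.2⟩)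
          have hcI : c ∈ Icc a b := ⟨hr.1.trans hcm.1.le, hcm.2.le⟩
          rw [hub, hclTy c hcI] at hce
          have h1 := hylow c hcI
          have hc0 := hpos c hcI
          have h2 : a ^ (m + 1) ≤ c ^ (m + 1) := pow_le_pow_left₀ ha.le hcI.1 _
          have h3 : - y c / c ^ (m + 1) ≤ H / a ^ (m + 1) := by
            have : - y c ≤ H := by linarith [hη.2]
            calc - y c / c ^ (m + 1) ≤ H / c ^ (m + 1) := by gcongr
              _ ≤ _ := by gcongr
          have h4 : - y c / c ^ (m + 1) * (b - r) ≤ H / a ^ (m + 1) * (b - a) :=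
            mul_le_mul h3 (by linarith [hr.1]) (by linarith) (by positivity)
          have h5 : - y c / c ^ (m + 1) = - (y c / c ^ (m + 1)) := by ring
          rw [h5] at h4
          linarith
        · rw [hub]; exact hM0
      rw [hg, hclM]; simp only
      rw [min_eq_left huM]
      unfold nonlin
      rw [max_comm 0 (u r), max_eq_left (le_max_right (u r) 0)]
    refine ⟨hcu, hcy, fun r hr => ?_, fun r hr => ?_, hub, hyb⟩
    · have := hdu r hr
      rwa [hclTy r (Ioo_subset_Icc_self hr)] at this
    · have := hdy r hr
      rwa [hgu r (Ioo_subset_Icc_self hr)] at this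
  · have h1 := (hα' a ⟨le_rfl, hab.le⟩).continuousOn
    have h2 : ContinuousOn (fun η : ℝ => ((0, -η) : ℝ × ℝ)) (Icc 0 H) := by fun_prop
    exact continuous_fst.comp_continuousOn (h1.comp h2 hball)

end Existence

/-! ### Shape of shooting solutions and comparison for small flux. -/

section Shape

variable {m : ℕ} {p lam a b η : ℝ} {u y : ℝ → ℝ}

theorem IsShooting.antitone (h : IsShooting m p lam a b η u y) (hl : 0 < lam) (ha : 0 < a) :
    AntitoneOn y (Icc a b) :=
  antitoneOn_Icc_of_hasDerivAt_nonpos h.conty h.dy fun r hr => by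
    have h0 : 0 < r := ha.trans hr.1
    have h1 := nonlin_nonneg (p := p) hl (u r)
    have : 0 ≤ r ^ (m + 1) * nonlin p lam (u r) := by positivity
    linarith

theorem IsShooting.exists_sub_eq (h : IsShooting m p lam a b η u y) {r s : ℝ}
    (har : a ≤ r) (hrs : r < s) (hsb : s ≤ b) :
    ∃ c ∈ Ioo r s, u s - u r = y c / c ^ (m + 1) * (s - r) :=
  exists_sub_eq_mul_of_hasDerivAt hrs (h.contu.mono (Icc_subset_Icc har hsb))
    fun x hx => h.du x ⟨har.trans_lt hx.1, hx.2.trans_le hsb⟩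

theorem IsShooting.le_mul_sub (h : IsShooting m p lam a b η u y) (hl : 0 < lam) (ha : 0 < a)
    (hη : 0 ≤ η) {r : ℝ} (hr : r ∈ Icc a b) : u r ≤ η / a ^ (m + 1) * (b - r) := by
  rcases hr.2.lt_or_eq with h1 | rfl
  · obtain ⟨c, hc, he⟩ := h.exists_sub_eq hr.1 h1 le_rfl
    have hcI : c ∈ Icc a b := ⟨hr.1.trans hc.1.le, hc.2.le⟩
    have hyc := h.antitone hl ha hcI ⟨hcI.1.trans hcI.2, le_rfl⟩ hcI.2
    rw [h.yb] at hyc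
    rw [h.ub] at he
    have hc0 : 0 < c := ha.trans_le hcI.1
    have h2 : a ^ (m + 1) ≤ c ^ (m + 1) := pow_le_pow_left₀ ha.le hcI.1 _
    have h3 : - y c / c ^ (m + 1) ≤ η / a ^ (m + 1) := by
      calc - y c / c ^ (m + 1) ≤ η / c ^ (m + 1) := by gcongr; linarith
        _ ≤ _ := by gcongr
    have h4 := mul_le_mul_of_nonneg_right h3 (sub_nonneg.2 hr.2)
    rw [neg_div] at h4
    linarith
  · simp [h.ub]

theorem IsShooting.mul_sub_le (h : IsShooting m p lam a b η u y) (hl : 0 < lam) (ha : 0 < a)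
    (hya : y a ≤ 0) {r : ℝ} (hr : r ∈ Icc a b) : - y a / b ^ (m + 1) * (b - r) ≤ u r := by
  rcases hr.2.lt_or_eq with h1 | rfl
  · obtain ⟨c, hc, he⟩ := h.exists_sub_eq hr.1 h1 le_rfl
    have hcI : c ∈ Icc a b := ⟨hr.1.trans hc.1.le, hc.2.le⟩
    have hyc := h.antitone hl ha ⟨le_rfl, hcI.1.trans hcI.2⟩ hcI hcI.1
    rw [h.ub] at he
    have hc0 : 0 < c := ha.trans_le hcI.1
    have h2 : c ^ (m + 1) ≤ b ^ (m + 1) := pow_le_pow_left₀ hc0.le hcI.2 _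
    have h3 : - y a / b ^ (m + 1) ≤ - y c / c ^ (m + 1) := by
      calc - y a / b ^ (m + 1) ≤ - y a / c ^ (m + 1) := by gcongr; linarith
        _ ≤ _ := by gcongr
    have h4 := mul_le_mul_of_nonneg_right h3 (sub_nonneg.2 hr.2)
    rw [neg_div (c ^ (m + 1))] at h4
    linarith
  · simp [h.ub]

/-- The flux decreases, so `u` rises and then falls. An interior value `≤ 0` would lie on the
falling part, forcing `u = 0` from there to `b` and hence zero flux at `b`. -/
theorem IsShooting.pos_of_nonneg_left (h : IsShooting m p lam a b η u y) (hl : 0 < lam)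
    (ha : 0 < a) (hη : 0 < η) (hua : 0 ≤ u a) {r : ℝ} (hr : r ∈ Ioo a b) : 0 < u r := by
  by_contra! hneg
  obtain ⟨c, hc, he⟩ := h.exists_sub_eq le_rfl hr.1 hr.2.le
  have hanti := h.antitone hl ha
  have hcI : c ∈ Icc a b := ⟨hc.1.le, (hc.2.trans hr.2).le⟩
  have hyc : y c ≤ 0 := by
    have hc0 : 0 < c ^ (m + 1) := pow_pos (ha.trans hc.1) _
    have h1 : y c / c ^ (m + 1) * (r - a) ≤ 0 := by linarith
    have h2 : y c / c ^ (m + 1) ≤ 0 := by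
      by_contra! hcon
      have := mul_pos hcon (sub_pos.2 hr.1)
      linarith
    by_contra! hcon
    have := div_pos hcon hc0
    linarith
  have hu : AntitoneOn u (Icc c b) :=
    antitoneOn_Icc_of_hasDerivAt_nonpos (h.contu.mono (Icc_subset_Icc_left hcI.1))
      (fun x hx => h.du x ⟨hcI.1.trans_lt hx.1, hx.2⟩) fun x hx => by
        have hx0 : 0 < x := ha.trans (hc.1.trans hx.1)
        have := hanti hcI ⟨hcI.1.trans hx.1.le, hx.2.le⟩ hx.1.le
        exact div_nonpos_of_nonpos_of_nonneg (by linarith) (by positivity)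
  have hbI : b ∈ Icc c b := ⟨hcI.2, le_rfl⟩
  have hzero : ∀ s ∈ Icc r b, u s = 0 := fun s hs => by
    have hsI : s ∈ Icc c b := ⟨hc.2.le.trans hs.1, hs.2⟩
    have h1 := hu hsI hbI hs.2
    have h2 := hu ⟨hc.2.le, hr.2.le⟩ hsI hs.1
    rw [h.ub] at h1
    linarith
  have hyzero : ∀ s ∈ Ioo r b, y s = 0 := fun s hs => by
    have h1 := h.du s ⟨hr.1.trans hs.1, hs.2⟩
    have h2 : HasDerivAt u 0 s := (hasDerivAt_const s (0:ℝ)).congr_of_eventuallyEq <| by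
      filter_upwards [Icc_mem_nhds hs.1 hs.2] with x hx using hzero x hx
    have h3 := h1.unique h2
    have hs0 : 0 < s := ha.trans (hr.1.trans hs.1)
    rcases div_eq_zero_iff.1 h3 with h4 | h4
    · exact h4
    · exact absurd h4 (by positivity)
  have h1 : Tendsto y (𝓝[Ioo r b] b) (𝓝 (y b)) :=
    (h.conty b ⟨(hr.1.trans hr.2).le, le_rfl⟩).mono
      (Ioo_subset_Icc_self.trans (Icc_subset_Icc_left hr.1.le))
  rw [nhdsWithin_Ioo_eq_nhdsLT hr.2] at h1
  have h2 : Tendsto y (𝓝[<] b) (𝓝 0) := tendsto_const_nhds.congr' <| by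
    filter_upwards [Ioo_mem_nhdsLT hr.2] with x hx using (hyzero x hx).symm
  have := tendsto_nhds_unique h1 h2
  rw [h.yb] at this
  linarith

/-- A shooting solution that is nonpositive at the left end has a zero, to the right of which
it is positive. -/
theorem IsShooting.exists_zero (h : IsShooting m p lam a b η u y) (hl : 0 < lam)
    (ha : 0 < a) (hab : a < b) (hη : 0 < η) (hua : u a ≤ 0) :
    ∃ z ∈ Ico a b, u z = 0 ∧ 0 < y z ∧ ∀ r ∈ Ioo z b, 0 < u r := by
  have hex : ∃ s ∈ Ioo a b, 0 < u s := by
    by_contra! hcon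
    have hyb : Tendsto y (𝓝[Ioo a b] b) (𝓝 (y b)) :=
      (h.conty b ⟨hab.le, le_rfl⟩).mono Ioo_subset_Icc_self
    rw [nhdsWithin_Ioo_eq_nhdsLT hab, h.yb] at hyb
    have hev := hyb.eventually (gt_mem_nhds (show -η < 0 by linarith))
    obtain ⟨s, hs⟩ := (hev.and (Ioo_mem_nhdsLT hab)).exists
    obtain ⟨c, hc, he⟩ := h.exists_sub_eq hs.2.1.le hs.2.2 le_rfl
    have hyc := h.antitone hl ha (Ioo_subset_Icc_self hs.2)
      ⟨hs.2.1.le.trans hc.1.le, hc.2.le⟩ hc.1.le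
    have hc0 : 0 < c := ha.trans (hs.2.1.trans hc.1)
    have h1 := hcon s hs.2
    have h2 : y c / c ^ (m + 1) < 0 := div_neg_of_neg_of_pos (by linarith [hs.1]) (by positivity)
    have h3 := mul_neg_of_neg_of_pos h2 (sub_pos.2 hs.2.2)
    rw [h.ub] at he
    linarith
  obtain ⟨s, hs, hus⟩ := hex
  obtain ⟨z, hz, hz0⟩ := intermediate_value_Icc hs.1.le
    (h.contu.mono (Icc_subset_Icc_right hs.2.le)) ⟨hua, hus.le⟩
  have hzb : z < b := hz.2.trans_lt hs.2
  have hpos : ∀ r ∈ Ioo z b, 0 < u r := fun r hr =>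
    (h.mono hz.1).pos_of_nonneg_left hl (ha.trans_le hz.1) hη hz0.ge hr
  refine ⟨z, ⟨hz.1, hzb⟩, hz0, ?_, hpos⟩
  -- Since `u` rises from `0` right after `z`, the flux is positive somewhere there, hence also at
  -- `z`.
  obtain ⟨w, hw⟩ := exists_between hzb
  obtain ⟨c, hc, he⟩ := h.exists_sub_eq hz.1 hw.1 hw.2.le
  have hyc := h.antitone hl ha ⟨hz.1, hzb.le⟩
      ⟨hz.1.trans hc.1.le, (hc.2.trans hw.2).le⟩ hc.1.le
  have hc0 : 0 < c := ha.trans_le (hz.1.trans hc.1.le)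
  have h1 := hpos w hw
  rw [hz0, sub_zero] at he
  by_contra! hcon
  have h2 : y c / c ^ (m + 1) ≤ 0 :=
    div_nonpos_of_nonpos_of_nonneg (by linarith) (by positivity)
  have h3 := mul_nonpos_of_nonpos_of_nonneg h2 (sub_nonneg.2 hw.1.le)
  linarith

/-- The linear terms cancel, so the Wronskian increases wherever `0 < u ≤ v`. Both comparisons with
the ball solution rest on this. -/
theorem IsShooting.wronskian_hasDerivAt {η' : ℝ} {v z : ℝ → ℝ}
    (h : IsShooting m p lam a b η u y) (h' : IsShooting m p lam a b η' v z) (ha : 0 < a)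
    {r : ℝ} (hr : r ∈ Ioo a b) (hu : 0 < u r) (hv : 0 < v r) :
    HasDerivAt (fun r => y r * v r - u r * z r)
      (r ^ (m + 1) * (u r * v r) * (v r ^ (p - 1) - u r ^ (p - 1))) r := by
  have hr0 : 0 < r := ha.trans hr.1
  have := ((h.dy r hr).mul (h'.du r hr)).sub ((h.du r hr).mul (h'.dy r hr))
  refine this.congr_deriv ?_
  rw [nonlin_of_pos' hu, nonlin_of_pos' hv]
  field_simp
  ring

/-- Shooting solutions of small flux stay below a fixed positive one, and so are positive. -/
theorem exists_forall_small_pos {η' : ℝ} {v z : ℝ → ℝ} (hp : 1 < p) (hl : 0 < lam) (ha : 0 < a)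
    (hab : a < b) (h' : IsShooting m p lam a b η' v z) (hza : z a < 0) :
    ∃ ε > 0, ∀ η u y, 0 < η → η < ε → IsShooting m p lam a b η u y →
      (∀ r ∈ Ico a b, 0 < v r) → 0 < u a := by
  have hb : 0 < b := ha.trans hab
  -- With this threshold the linear upper bound for `u` lies below the linear lower bound for `v`.
  refine ⟨a ^ (m + 1) * (- z a / b ^ (m + 1)), ?_, fun η u y hη hηε h hv => ?_⟩
  · have : 0 < - z a := by linarith
    positivity
  by_contra! hcon
  obtain ⟨x, hx, hux, hyx, hpos⟩ := h.exists_zero hl ha hab hη hcon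
  have hlt : ∀ r ∈ Ico a b, u r < v r := fun r hr => by
    refine (h.le_mul_sub hl ha hη.le ⟨hr.1, hr.2.le⟩).trans_lt
      (lt_of_lt_of_le ?_ (h'.mul_sub_le hl ha hza.le ⟨hr.1, hr.2.le⟩))
    have h1 : η / a ^ (m + 1) < - z a / b ^ (m + 1) := by
      rw [div_lt_iff₀ (by positivity)]; linarith
    exact mul_lt_mul_of_pos_right h1 (by linarith [hr.2])
  have hx0 : 0 < x := ha.trans_le hx.1
  have hsub : Icc x b ⊆ Icc a b := Icc_subset_Icc_left hx.1
  -- The Wronskian increases from `y x * v x > 0` at the zero `x` of `u` to `0` at `b`: a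
  -- contradiction.
  have hmono := monotoneOn_Icc_of_hasDerivAt_nonneg (a := x) (b := b)
    (((h.conty.mul h'.contu).sub (h.contu.mul h'.conty)).mono hsub)
    (fun r hr => h.wronskian_hasDerivAt h' ha ⟨hx.1.trans_lt hr.1, hr.2⟩ (hpos r hr)
      (hv r ⟨hx.1.trans hr.1.le, hr.2⟩)) (fun r hr => by
        have h1 := hpos r hr
        have h2 := hlt r ⟨hx.1.trans hr.1.le, hr.2⟩
        have h3 : 0 < v r := h1.trans h2
        have h4 : u r ^ (p - 1) ≤ v r ^ (p - 1) :=
          Real.rpow_le_rpow h1.le h2.le (by linarith)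
        have hr0 : 0 < r := hx0.trans hr.1
        exact mul_nonneg (by positivity) (by linarith))
  have h1 : y x * v x - u x * z x ≤ y b * v b - u b * z b :=
    hmono ⟨le_rfl, hx.2.le⟩ ⟨hx.2.le, le_rfl⟩ hx.2.le
  rw [h.ub, h'.ub, hux] at h1
  have := mul_pos hyx (hv x hx)
  linarith

end Shape

/-! ### Sign change for large flux. -/

section LargeFlux

variable {m : ℕ} {p lam a b η : ℝ} {u y : ℝ → ℝ}

/-- A Harnack inequality. Monotone flux makes `u` concave up to the weight ratio `b ^ (m + 1) / a ^
(m + 1)`: a steep climb away from `c` on one side needs a slope at least comparable on the other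
side, where a length of at least `(b - a) / 3` is available. -/
theorem IsShooting.le_mul_middle (h : IsShooting m p lam a b η u y) (hl : 0 < lam) (ha : 0 < a)
    (hη : 0 < η) (hua : 0 ≤ u a) {c r : ℝ} (hc : c ∈ Icc ((2 * a + b) / 3) ((a + 2 * b) / 3))
    (hab : a < b) (hr : r ∈ Icc a b) :
    u r ≤ (1 + 3 * (b ^ (m + 1) / a ^ (m + 1))) * u c := by
  have hb : 0 < b := ha.trans hab
  have hac : a < c := by linarith [hc.1]
  have hcb : c < b := by linarith [hc.2]
  have huc : 0 < u c := h.pos_of_nonneg_left hl ha hη hua ⟨hac, hcb⟩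
  have hanti := h.antitone hl ha
  set q : ℝ := b ^ (m + 1) / a ^ (m + 1) with hq
  have hq0 : 0 < q := by positivity
  rcases lt_trichotomy c r with hcr | rfl | hrc
  · obtain ⟨x, hx, hxe⟩ := h.exists_sub_eq hac.le hcr hr.2
    obtain ⟨w, hw, hwe⟩ := h.exists_sub_eq le_rfl hac hcb.le
    rcases le_total (y x) 0 with h0 | h0
    · have hx0 : 0 < x := ha.trans (hac.trans hx.1)
      have h1 : y x / x ^ (m + 1) * (r - c) ≤ 0 := mul_nonpos_of_nonpos_of_nonneg
        (div_nonpos_of_nonpos_of_nonneg h0 (by positivity)) (by linarith)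
      have : 0 ≤ 3 * q * u c := by positivity
      linarith
    · have hw0 : 0 < w := ha.trans hw.1
      have hyw : y x ≤ y w := hanti ⟨hw.1.le, (hw.2.trans hcb).le⟩
        ⟨(hac.trans hx.1).le, hx.2.le.trans hr.2⟩ (hw.2.trans hx.1).le
      have e1 : y x / b ^ (m + 1) * ((b - a) / 3) ≤ y w / w ^ (m + 1) * (c - a) := by
        have h2 : w ^ (m + 1) ≤ b ^ (m + 1) := pow_le_pow_left₀ hw0.le (hw.2.trans hcb).le _
        have h3 : (b - a) / 3 ≤ c - a := by linarith [hc.1]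
        have h4 : 0 ≤ (b - a) / 3 := by linarith
        have h5 : 0 ≤ y w := h0.trans hyw
        gcongr
      have e2 : y x / x ^ (m + 1) * (r - c) ≤ y x / a ^ (m + 1) * (b - a) := by
        have h2 : a ^ (m + 1) ≤ x ^ (m + 1) := pow_le_pow_left₀ ha.le (hac.trans hx.1).le _
        have h3 : r - c ≤ b - a := by linarith [hr.2]
        have h4 : 0 ≤ r - c := by linarith
        gcongr
      have e3 : y x / a ^ (m + 1) * (b - a) = 3 * q * (y x / b ^ (m + 1) * ((b - a) / 3)) := by
        rw [hq]; field_simp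
      have e4 : y x / b ^ (m + 1) * ((b - a) / 3) ≤ u c := by linarith
      have e5 := mul_le_mul_of_nonneg_left e4 (show 0 ≤ 3 * q by positivity)
      linarith
  · have : 0 ≤ 3 * q * u c := by positivity
    linarith
  · obtain ⟨x, hx, hxe⟩ := h.exists_sub_eq hr.1 hrc hcb.le
    obtain ⟨w, hw, hwe⟩ := h.exists_sub_eq hac.le hcb le_rfl
    rw [h.ub] at hwe
    have hx0 : 0 < x := ha.trans_le (hr.1.trans hx.1.le)
    rcases le_total 0 (y x) with h0 | h0
    · have h1 : 0 ≤ y x / x ^ (m + 1) * (c - r) := mul_nonneg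
        (div_nonneg h0 (by positivity)) (by linarith)
      have : 0 ≤ 3 * q * u c := by positivity
      linarith
    · have hw0 : 0 < w := ha.trans (hac.trans hw.1)
      have hyw : - y x ≤ - y w := neg_le_neg (hanti ⟨hr.1.trans hx.1.le, (hx.2.trans hcb).le⟩
        ⟨(hac.trans hw.1).le, hw.2.le⟩ (hx.2.trans hw.1).le)
      have h00 : 0 ≤ - y x := by linarith
      have e1 : - y x / b ^ (m + 1) * ((b - a) / 3) ≤ - y w / w ^ (m + 1) * (b - c) := by
        have h2 : w ^ (m + 1) ≤ b ^ (m + 1) := pow_le_pow_left₀ hw0.le hw.2.le _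
        have h3 : (b - a) / 3 ≤ b - c := by linarith [hc.2]
        have h4 : 0 ≤ (b - a) / 3 := by linarith
        have h5 : 0 ≤ - y w := by linarith
        gcongr
      have e2 : - y x / x ^ (m + 1) * (c - r) ≤ - y x / a ^ (m + 1) * (b - a) := by
        have h2 : a ^ (m + 1) ≤ x ^ (m + 1) := pow_le_pow_left₀ ha.le (hr.1.trans hx.1.le) _
        have h3 : c - r ≤ b - a := by linarith [hr.1]
        have h4 : 0 ≤ c - r := by linarith
        gcongr
      have e3 : - y x / a ^ (m + 1) * (b - a) =
          3 * q * (- y x / b ^ (m + 1) * ((b - a) / 3)) := by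
        rw [hq]; field_simp
      rw [neg_div (w ^ (m + 1))] at e1
      rw [neg_div (x ^ (m + 1))] at e2
      have e4 : - y x / b ^ (m + 1) * ((b - a) / 3) ≤ u c := by linarith
      have e5 := mul_le_mul_of_nonneg_left e4 (show 0 ≤ 3 * q by positivity)
      linarith

/-- The harmonic variable `-1 / (m r ^ m)`, in which the radial Laplacian has no first order
term. -/
noncomputable def harmonicVar (m : ℕ) (r : ℝ) : ℝ := -1 / (m * r ^ m)

theorem hasDerivAt_harmonicVar (hm : 0 < m) {r : ℝ} (hr : 0 < r) :
    HasDerivAt (harmonicVar m) (1 / r ^ (m + 1)) r := by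
  obtain ⟨k, rfl⟩ : ∃ k, m = k + 1 := ⟨m - 1, by omega⟩
  have h1 : HasDerivAt (fun r : ℝ => ((k + 1 : ℕ) : ℝ) * r ^ (k + 1)) _ r :=
    (hasDerivAt_pow (k + 1) r).const_mul _
  have h2 := (hasDerivAt_const r (-1 : ℝ)).div h1 (by positivity)
  refine h2.congr_deriv ?_
  have : ((k + 1 : ℕ) : ℝ) ≠ 0 := by positivity
  simp only [Nat.add_sub_cancel]
  field_simp
  ring

theorem strictMonoOn_harmonicVar (hm : 0 < m) : StrictMonoOn (harmonicVar m) (Ioi 0) := by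
  intro r hr s hs hrs
  have hr' : 0 < r := hr
  have hm' : (0:ℝ) < m := by exact_mod_cast hm
  unfold harmonicVar
  rw [neg_div, neg_div, neg_lt_neg_iff]
  have : r ^ m < s ^ m := pow_lt_pow_left₀ hrs hr'.le hm.ne'
  gcongr

/-- Sturm comparison: a large potential forces a zero. -/
theorem IsShooting.exists_small_potential (h : IsShooting m p lam a b η u y) (hm : 0 < m)
    (ha : 0 < a) {c d : ℝ} (hac : a < c) (hcd : c < d) (hdb : d < b)
    (hpos : ∀ r ∈ Icc c d, 0 < u r) :
    ∃ r ∈ Icc c d, lam + u r ^ (p - 1) <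
      (Real.pi / (harmonicVar m d - harmonicVar m c)) ^ 2 / c ^ (2 * (m + 1)) := by
  have hc0 : 0 < c := ha.trans hac
  set T := harmonicVar m with hT
  have hTm : StrictMonoOn T (Ioi 0) := strictMonoOn_harmonicVar hm
  have hTcd : 0 < T d - T c := sub_pos.2 (hTm hc0 (hc0.trans hcd) hcd)
  set k : ℝ := Real.pi / (T d - T c) with hk
  have hk0 : 0 < k := div_pos Real.pi_pos hTcd
  have hkd : k * (T d - T c) = Real.pi := by rw [hk]; field_simp
  by_contra! hcon
  have hTd : ∀ r ∈ Icc c d, HasDerivAt (fun r => k * (T r - T c)) (k * (1 / r ^ (m + 1))) r :=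
    fun r hr => ((hasDerivAt_harmonicVar hm (hc0.trans_le hr.1)).sub_const _).const_mul k
  -- Wronskian of `u` with one arch of a sine in the harmonic variable, vanishing at `c` and `d`. A
  -- large potential makes it decrease, yet it goes from `-k * u c` to `k * u d`.
  have hW : ∀ r ∈ Icc c d, HasDerivAt
      (fun r => y r * Real.sin (k * (T r - T c)) - u r * (k * Real.cos (k * (T r - T c))))
      (-(u r * Real.sin (k * (T r - T c)) *
        (r ^ (m + 1) * (lam + u r ^ (p - 1)) - k ^ 2 / r ^ (m + 1)))) r := by
    intro r hr
    have hrI : r ∈ Ioo a b := ⟨hac.trans_le hr.1, hr.2.trans_lt hdb⟩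
    have hr0 : 0 < r := ha.trans hrI.1
    have := ((h.dy r hrI).mul (hTd r hr).sin).sub
      ((h.du r hrI).mul ((hTd r hr).cos.const_mul k))
    refine this.congr_deriv ?_
    rw [nonlin_of_pos' (hpos r hr)]
    field_simp
    ring
  have hmono := antitoneOn_Icc_of_hasDerivAt_nonpos
    (fun r hr => (hW r hr).continuousAt.continuousWithinAt)
    (fun r hr => hW r (Ioo_subset_Icc_self hr)) (fun r hr => by
      have hr' := Ioo_subset_Icc_self hr
      have hr0 : 0 < r := hc0.trans hr.1
      have hu := hpos r hr'
      have h1 : 0 ≤ Real.sin (k * (T r - T c)) := by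
        apply Real.sin_nonneg_of_nonneg_of_le_pi
        · have := hTm.monotoneOn hc0 hr0 hr.1.le
          exact mul_nonneg hk0.le (by linarith)
        · rw [← hkd]
          have := hTm.monotoneOn hr0 (hc0.trans hcd) hr.2.le
          gcongr
      have h2 : k ^ 2 / r ^ (m + 1) ≤ r ^ (m + 1) * (lam + u r ^ (p - 1)) := by
        rw [div_le_iff₀ (by positivity)]
        have h3 := hcon r hr'
        rw [div_le_iff₀ (by positivity)] at h3
        have h4 : c ^ (2 * (m + 1)) ≤ r ^ (2 * (m + 1)) := pow_le_pow_left₀ hc0.le hr.1.le _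
        have h5 : 0 ≤ lam + u r ^ (p - 1) := by
          refine le_trans ?_ (hcon r hr')
          positivity
        calc k ^ 2 ≤ (lam + u r ^ (p - 1)) * c ^ (2 * (m + 1)) := h3
          _ ≤ (lam + u r ^ (p - 1)) * r ^ (2 * (m + 1)) := by gcongr
          _ = _ := by ring
      have := mul_nonneg (mul_nonneg hu.le h1) (sub_nonneg.2 h2)
      linarith)
  have h1 := hmono ⟨le_rfl, hcd.le⟩ ⟨hcd.le, le_rfl⟩ hcd.le
  simp only [hkd, sub_self, mul_zero, Real.sin_zero, Real.cos_zero, Real.sin_pi,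
    Real.cos_pi] at h1
  have h2 := mul_pos (hpos c ⟨le_rfl, hcd.le⟩) hk0
  have h3 := mul_pos (hpos d ⟨hcd.le, le_rfl⟩) hk0
  linarith

/-- A shooting solution of large flux changes sign. -/
theorem exists_forall_large_neg (hm : 0 < m) (hp : 1 < p) (hl : 0 < lam) (ha : 0 < a)
    (hab : a < b) :
    ∃ E > 0, ∀ η u y, E < η → IsShooting m p lam a b η u y → u a < 0 := by
  have hb : 0 < b := ha.trans hab
  set c : ℝ := (2 * a + b) / 3 with hc
  set d : ℝ := (a + 2 * b) / 3 with hd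
  have hac : a < c := by rw [hc]; linarith
  have hcd : c < d := by rw [hc, hd]; linarith
  have hdb : d < b := by rw [hd]; linarith
  have hc0 : 0 < c := ha.trans hac
  set G : ℝ := (Real.pi / (harmonicVar m d - harmonicVar m c)) ^ 2 / c ^ (2 * (m + 1)) with hG
  have hG0 : 0 ≤ G := by positivity
  set K : ℝ := G ^ (1 / (p - 1)) with hK
  have hK0 : 0 ≤ K := Real.rpow_nonneg hG0 _
  set q : ℝ := b ^ (m + 1) / a ^ (m + 1) with hq
  set M : ℝ := (1 + 3 * q) * K with hM
  have hM0 : 0 ≤ M := by positivity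
  have hba : 0 < b - a := by linarith
  have hnM := nonlin_nonneg (p := p) hl M
  -- If `u a ≥ 0`, Sturm and Harnack give `u ≤ M`. The first term bounds the flux at a mean value
  -- point, the second its change from there to `b`.
  refine ⟨b ^ (m + 1) * M / (b - a) + b ^ (m + 1) * nonlin p lam M * (b - a) + 1, by positivity,
    fun η u y hη h => ?_⟩
  have hη0 : 0 < η := lt_trans (by positivity) hη
  by_contra! hua
  have hpos : ∀ r ∈ Icc c d, 0 < u r := fun r hr =>
    h.pos_of_nonneg_left hl ha hη0 hua ⟨hac.trans_le hr.1, hr.2.trans_lt hdb⟩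
  obtain ⟨s, hs, hsG⟩ := h.exists_small_potential hm ha hac hcd hdb hpos
  have hsK : u s ≤ K := by
    have h1 : u s ^ (p - 1) ≤ G := by linarith
    have h2 := Real.rpow_le_rpow (Real.rpow_nonneg (hpos s hs).le _) h1
      (show 0 ≤ 1 / (p - 1) by have : 0 < p - 1 := by linarith
                               positivity)
    rwa [← Real.rpow_mul (hpos s hs).le, mul_one_div_cancel (by linarith), Real.rpow_one] at h2
  have huM : ∀ r ∈ Icc a b, u r ≤ M := fun r hr => by
    refine (h.le_mul_middle hl ha hη0 hua hs hab hr).trans ?_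
    rw [hM]; gcongr
  obtain ⟨x, hx, hxe⟩ := h.exists_sub_eq le_rfl hab le_rfl
  obtain ⟨w, hw, hwe⟩ := exists_sub_eq_mul_of_hasDerivAt hx.2
    (h.conty.mono (Icc_subset_Icc_left hx.1.le)) (fun r hr => h.dy r ⟨hx.1.trans hr.1, hr.2⟩)
  have hx0 : 0 < x := ha.trans hx.1
  have hw0 : 0 < w := hx0.trans hw.1
  have e1 : - y x ≤ b ^ (m + 1) * M / (b - a) := by
    have h1 : - y x = x ^ (m + 1) * u a / (b - a) := by
      rw [h.ub] at hxe
      field_simp at hxe ⊢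
      linarith
    have h2 := huM a ⟨le_rfl, hab.le⟩
    rw [h1]
    have := hx.2.le
    gcongr
  have e2 : w ^ (m + 1) * nonlin p lam (u w) * (b - x) ≤
      b ^ (m + 1) * nonlin p lam M * (b - a) := by
    have h1 : nonlin p lam (u w) ≤ nonlin p lam M :=
      nonlin_mono hp hl (huM w ⟨(hx.1.trans hw.1).le, hw.2.le⟩)
    have h2 := nonlin_nonneg (p := p) hl (u w)
    have h3 := hx.1.le
    have h4 := hw.2.le
    have h5 : 0 ≤ b - x := by linarith [hx.2]
    gcongr
  rw [h.yb] at hwe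
  linarith

end LargeFlux

/-! ### Positive solutions on the punctured ball: a priori bounds at the origin. -/

/-- A positive solution on all of `(0, b)`, possibly singular at the origin. -/
structure IsEntire (m : ℕ) (p lam b η : ℝ) (u y : ℝ → ℝ) : Prop where
  shoot : ∀ a ∈ Ioo 0 b, IsShooting m p lam a b η u y
  pos : ∀ r ∈ Ioo 0 b, 0 < u r

section Entire

variable {m : ℕ} {p lam b η : ℝ} {u y : ℝ → ℝ}

theorem IsEntire.du (h : IsEntire m p lam b η u y) {r : ℝ} (hr : r ∈ Ioo 0 b) :
    HasDerivAt u (y r / r ^ (m + 1)) r :=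
  (h.shoot (r / 2) ⟨by linarith [hr.1], by linarith [hr.1, hr.2]⟩).du r
    ⟨by linarith [hr.1], hr.2⟩

theorem IsEntire.dy (h : IsEntire m p lam b η u y) {r : ℝ} (hr : r ∈ Ioo 0 b) :
    HasDerivAt y (-(r ^ (m + 1) * nonlin p lam (u r))) r :=
  (h.shoot (r / 2) ⟨by linarith [hr.1], by linarith [hr.1, hr.2]⟩).dy r
    ⟨by linarith [hr.1], hr.2⟩

theorem IsEntire.conty (h : IsEntire m p lam b η u y) : ContinuousOn y (Ioo 0 b) :=
  fun _ hr => (h.dy hr).continuousAt.continuousWithinAt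

theorem IsEntire.antitone (h : IsEntire m p lam b η u y) (hl : 0 < lam) :
    AntitoneOn y (Ioc 0 b) := fun r hr s hs hrs => by
  rcases hrs.lt_or_eq with h1 | rfl
  · exact (h.shoot r ⟨hr.1, h1.trans_le hs.2⟩).antitone hl hr.1 ⟨le_rfl, hr.2⟩ ⟨hrs, hs.2⟩ hrs
  · exact le_rfl

/-- A nonnegative flux would be bounded below by a positive number near the origin. Then `u` would
increase across `[s, 2 * s]` by at least a multiple of `s ^ (-m)`, which is unbounded, while staying
between `0` and `u t`. -/
theorem IsEntire.flux_neg (h : IsEntire m p lam b η u y) (hl : 0 < lam) (hm : 0 < m)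
    {r : ℝ} (hr : r ∈ Ioo 0 b) : y r < 0 := by
  by_contra! hcon
  obtain ⟨t, ht⟩ := exists_between hr.1
  have htb : t < b := ht.2.trans hr.2
  have hyt : 0 < y t := by
    obtain ⟨c, hc, he⟩ := exists_sub_eq_mul_of_hasDerivAt ht.2
      (h.conty.mono fun x hx => ⟨ht.1.trans_le hx.1, hx.2.trans_lt hr.2⟩)
      (fun x hx => h.dy ⟨ht.1.trans hx.1, hx.2.trans hr.2⟩)
    have hcI : c ∈ Ioo 0 b := ⟨ht.1.trans hc.1, hc.2.trans hr.2⟩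
    have hc0 : 0 < c := hcI.1
    have huc := h.pos c hcI
    have : 0 < c ^ (m + 1) * nonlin p lam (u c) * (r - t) := by
      rw [nonlin_of_pos huc]
      have : 0 < r - t := by linarith [ht.2]
      positivity
    linarith
  have key : ∀ s ∈ Ioo 0 (t / 2), y t ≤ 2 ^ (m + 1) * s ^ m * u t := by
    intro s hs
    have hs0 : 0 < s := hs.1
    have hst : 2 * s < t := by linarith [hs.2]
    have hsh := h.shoot s ⟨hs.1, by linarith⟩
    have hmono : MonotoneOn u (Icc s t) := monotoneOn_Icc_of_hasDerivAt_nonneg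
      (hsh.contu.mono (Icc_subset_Icc_right htb.le))
      (fun x hx => hsh.du x ⟨hx.1, hx.2.trans htb⟩) fun x hx => by
        have hx0 : 0 < x := hs0.trans hx.1
        have := h.antitone hl ⟨hx0, (hx.2.trans htb).le⟩ ⟨ht.1, htb.le⟩ hx.2.le
        exact div_nonneg (by linarith) (by positivity)
    obtain ⟨c, hc, he⟩ := hsh.exists_sub_eq le_rfl (show s < 2 * s by linarith) (by linarith)
    have hc0 : 0 < c := hs0.trans hc.1
    have h1 : y t ≤ y c :=
      h.antitone hl ⟨hc0, by linarith [hc.2]⟩ ⟨ht.1, htb.le⟩ (by linarith [hc.2])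
    have h2 : u (2 * s) ≤ u t :=
      hmono ⟨by linarith, hst.le⟩ ⟨by linarith, le_rfl⟩ hst.le
    have h3 := h.pos s ⟨hs0, by linarith⟩
    have h4 : y t / (2 * s) ^ (m + 1) * s ≤ y c / c ^ (m + 1) * (2 * s - s) := by
      have h5 : c ^ (m + 1) ≤ (2 * s) ^ (m + 1) := pow_le_pow_left₀ hc0.le hc.2.le _
      have h6 : 0 ≤ y c := hyt.le.trans h1
      rw [show 2 * s - s = s by ring]
      gcongr
    have h7 : y t / (2 * s) ^ (m + 1) * s ≤ u t := by linarith
    have h8 : y t / (2 * s) ^ (m + 1) * s = y t / (2 ^ (m + 1) * s ^ m) := by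
      rw [mul_pow, pow_succ s]; field_simp
    rw [h8, div_le_iff₀ (by positivity)] at h7
    linarith
  have hlim : Tendsto (fun s : ℝ => 2 ^ (m + 1) * s ^ m * u t) (𝓝[>] 0) (𝓝 0) := by
    have : Continuous (fun s : ℝ => 2 ^ (m + 1) * s ^ m * u t) := by fun_prop
    have h1 := this.tendsto 0
    simp only [zero_pow hm.ne', mul_zero, zero_mul] at h1
    exact h1.mono_left nhdsWithin_le_nhds
  have := ge_of_tendsto hlim (by
    filter_upwards [Ioo_mem_nhdsGT (show (0:ℝ) < t / 2 by linarith [ht.1])] with s hs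
      using key s hs)
  linarith

theorem IsEntire.eta_pos (h : IsEntire m p lam b η u y) (hl : 0 < lam) (hm : 0 < m)
    (hb : 0 < b) : 0 < η := by
  have hI : b / 2 ∈ Ioo 0 b := ⟨by linarith, by linarith⟩
  have h1 := h.flux_neg hl hm hI
  have h2 := h.antitone hl ⟨hI.1, hI.2.le⟩ ⟨hb, le_rfl⟩ hI.2.le
  rw [(h.shoot _ hI).yb] at h2
  linarith

theorem IsEntire.u_antitone (h : IsEntire m p lam b η u y) (hl : 0 < lam) (hm : 0 < m) :
    AntitoneOn u (Ioc 0 b) := fun r hr s hs hrs => by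
  rcases hrs.lt_or_eq with h1 | rfl
  · have hsh := h.shoot r ⟨hr.1, h1.trans_le hs.2⟩
    refine antitoneOn_Icc_of_hasDerivAt_nonpos hsh.contu hsh.du (fun x hx => ?_)
      ⟨le_rfl, hr.2⟩ ⟨hrs, hs.2⟩ hrs
    have hx0 : 0 < x := hr.1.trans hx.1
    exact div_nonpos_of_nonpos_of_nonneg (h.flux_neg hl hm ⟨hx0, hx.2⟩).le (by positivity)
  · exact le_rfl

theorem le_of_forall_small_le {x C : ℝ} {n : ℕ} (hn : 0 < n) {t : ℝ} (ht : 0 < t)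
    (h : ∀ s ∈ Ioo 0 t, x ≤ C * s ^ n) : x ≤ 0 := by
  have hlim : Tendsto (fun s : ℝ => C * s ^ n) (𝓝[>] 0) (𝓝 0) := by
    have : Continuous (fun s : ℝ => C * s ^ n) := by fun_prop
    have h1 := this.tendsto 0
    simp only [zero_pow hn.ne', mul_zero] at h1
    exact h1.mono_left nhdsWithin_le_nhds
  exact ge_of_tendsto hlim (by filter_upwards [Ioo_mem_nhdsGT ht] with s hs using h s hs)

/-- Integrate the flux equation from `s` to `r`, using that `u` decreases and `y s < 0`, and let `s
→ 0`. -/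
theorem IsEntire.flux_le (h : IsEntire m p lam b η u y) (hp : 1 < p) (hl : 0 < lam)
    (hm : 0 < m) {r : ℝ} (hr : r ∈ Ioo 0 b) : y r + u r ^ p * r ^ (m + 2) / (m + 2) ≤ 0 := by
  have hur := h.pos r hr
  refine le_of_forall_small_le (n := m + 2) (C := u r ^ p / (m + 2)) (by omega) hr.1
    fun s hs => ?_
  have hsub : Icc s r ⊆ Ioo 0 b := fun x hx => ⟨hs.1.trans_le hx.1, hx.2.trans_lt hr.2⟩
  have hd : ∀ x ∈ Icc s r, HasDerivAt (fun x => y x + u r ^ p * x ^ (m + 2) / (m + 2))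
      (-(x ^ (m + 1) * nonlin p lam (u x)) + u r ^ p * x ^ (m + 1)) x := fun x hx => by
    have h1 := (((hasDerivAt_pow (m + 2) x).const_mul (u r ^ p)).div_const ((m : ℝ) + 2))
    refine ((h.dy (hsub hx)).add h1).congr_deriv ?_
    have : (m : ℝ) + 2 ≠ 0 := by positivity
    push_cast
    field_simp
  have hanti := antitoneOn_Icc_of_hasDerivAt_nonpos
    (fun x hx => (hd x hx).continuousAt.continuousWithinAt)
    (fun x hx => hd x (Ioo_subset_Icc_self hx)) fun x hx => by
      have hxI := hsub (Ioo_subset_Icc_self hx)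
      have hx0 : 0 < x := hxI.1
      have hux := h.pos x hxI
      have h1 : u r ≤ u x := h.u_antitone hl hm ⟨hxI.1, hxI.2.le⟩ ⟨hr.1, hr.2.le⟩ hx.2.le
      have h2 : u r ^ p ≤ u x ^ p := Real.rpow_le_rpow hur.le h1 (by linarith)
      rw [nonlin_of_pos hux]
      have h3 : 0 ≤ lam * u x := by positivity
      have h4 : x ^ (m + 1) * u r ^ p ≤ x ^ (m + 1) * (lam * u x + u x ^ p) := by
        gcongr; linarith
      linarith
  have h1 := hanti ⟨le_rfl, hs.2.le⟩ ⟨hs.2.le, le_rfl⟩ hs.2.le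
  have h2 := h.flux_neg hl hm (hsub ⟨le_rfl, hs.2.le⟩)
  simp only at h1
  rw [div_mul_eq_mul_div]
  linarith

/-- The universal upper bound for positive solutions on a punctured ball. -/
theorem IsEntire.sq_mul_rpow_le (h : IsEntire m p lam b η u y) (hp : 1 < p) (hl : 0 < lam)
    (hm : 0 < m) {r : ℝ} (hr : r ∈ Ioo 0 b) :
    r ^ 2 * u r ^ (p - 1) ≤ 2 * (m + 2) / (p - 1) := by
  have hur := h.pos r hr
  have hp1 : 0 < p - 1 := by linarith
  have hm2 : (0 : ℝ) < m + 2 := by positivity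
  set κ : ℝ := (p - 1) / (2 * (m + 2)) with hκ
  have hκ0 : 0 < κ := by positivity
  -- By `flux_le`, `u ^ (1 - p)` grows at least as fast as `κ * r ^ 2`. At the origin only its
  -- positivity is needed.
  have hmain : κ * r ^ 2 - u r ^ (1 - p) ≤ 0 := by
    refine le_of_forall_small_le (n := 2) (C := κ) (by omega) hr.1 fun s hs => ?_
    have hsub : Icc s r ⊆ Ioo 0 b := fun x hx => ⟨hs.1.trans_le hx.1, hx.2.trans_lt hr.2⟩
    have hd : ∀ x ∈ Icc s r, HasDerivAt (fun x => κ * x ^ 2 - u x ^ (1 - p))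
        (κ * (2 * x) - y x / x ^ (m + 1) * (1 - p) * u x ^ (1 - p - 1)) x := fun x hx => by
      have h1 := (h.du (hsub hx)).rpow_const (p := 1 - p) (Or.inl (h.pos x (hsub hx)).ne')
      have h2 := (hasDerivAt_pow 2 x).const_mul κ
      refine (h2.sub h1).congr_deriv ?_
      norm_num
    have hanti := antitoneOn_Icc_of_hasDerivAt_nonpos
      (fun x hx => (hd x hx).continuousAt.continuousWithinAt)
      (fun x hx => hd x (Ioo_subset_Icc_self hx)) fun x hx => by
        have hxI := hsub (Ioo_subset_Icc_self hx)
        have hx0 : 0 < x := hxI.1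
        have hux := h.pos x hxI
        have h1 := h.flux_le hp hl hm hxI
        have h2 : u x ^ (1 - p - 1) = (u x ^ p)⁻¹ := by
          rw [show 1 - p - 1 = -p by ring, Real.rpow_neg hux.le]
        have h3 : 0 < u x ^ p := Real.rpow_pos_of_pos hux _
        rw [h2, hκ]
        have h4 : (p - 1) / (2 * (m + 2)) * (2 * x) - y x / x ^ (m + 1) * (1 - p) * (u x ^ p)⁻¹
            = (p - 1) / (x ^ (m + 1) * u x ^ p) * (y x + u x ^ p * x ^ (m + 2) / (m + 2)) := by
          field_simp
          ring
        rw [h4]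
        exact mul_nonpos_of_nonneg_of_nonpos (by positivity) h1
    have h1 := hanti ⟨le_rfl, hs.2.le⟩ ⟨hs.2.le, le_rfl⟩ hs.2.le
    have h2 : 0 ≤ u s ^ (1 - p) :=
      Real.rpow_nonneg (h.pos s (hsub ⟨le_rfl, hs.2.le⟩)).le _
    simp only at h1
    linarith
  have h3 : u r ^ (p - 1) * u r ^ (1 - p) = 1 := by
    rw [← Real.rpow_add hur]; norm_num
  have h4 : 0 < u r ^ (p - 1) := Real.rpow_pos_of_pos hur _
  have h5 := mul_le_mul_of_nonneg_left (sub_nonpos.1 hmain) h4.le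
  rw [h3] at h5
  rw [hκ] at h5
  rw [le_div_iff₀ hp1]
  have h6 : u r ^ (p - 1) * ((p - 1) / (2 * (m + 2)) * r ^ 2) =
    r ^ 2 * u r ^ (p - 1) * (p - 1) / (2 * (m + 2)) := by ring
  rw [h6, div_le_one (by positivity)] at h5
  exact h5

/-- The exponent `m - 4 / (p - 1)` is positive exactly in the supercritical range, so there the
boundary terms at the origin vanish. -/
theorem IsEntire.pow_mul_sq_le (h : IsEntire m p lam b η u y) (hp : 1 < p) (hl : 0 < lam)
    (hm : 0 < m) {r : ℝ} (hr : r ∈ Ioo 0 b) :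
    u r ^ 2 * r ^ m ≤ (2 * (m + 2) / (p - 1)) ^ (2 / (p - 1)) * r ^ (m - 4 / (p - 1)) := by
  have hur := h.pos r hr
  have hr0 : 0 < r := hr.1
  have hp1 : 0 < p - 1 := by linarith
  have h1 := h.sq_mul_rpow_le hp hl hm hr
  have h2 := Real.rpow_le_rpow (by positivity) h1 (show 0 ≤ 2 / (p - 1) by positivity)
  rw [Real.mul_rpow (by positivity) (by positivity), ← Real.rpow_mul hur.le,
    mul_div_cancel₀ _ hp1.ne', ← Real.rpow_natCast r 2, ← Real.rpow_mul hr0.le] at h2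
  have h3 : (r : ℝ) ^ (m - 4 / (p - 1)) * r ^ (((2 : ℕ) : ℝ) * (2 / (p - 1))) = r ^ m := by
    rw [← Real.rpow_add hr0, ← Real.rpow_natCast r m]
    congr 1
    push_cast
    ring
  calc u r ^ 2 * r ^ m = (r ^ (((2 : ℕ) : ℝ) * (2 / (p - 1))) * u r ^ (2 : ℝ)) *
        r ^ (m - 4 / (p - 1)) := by rw [← h3, Real.rpow_two]; ring
    _ ≤ _ := by gcongr

/-- The drop of `u` across `[r, 2 * r]` is at most `u r`, and `-y` is at least `-y r` there. -/
theorem IsEntire.neg_flux_le (h : IsEntire m p lam b η u y) (hl : 0 < lam)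
    {r : ℝ} (hr : 0 < r) (hrb : 2 * r < b) : - y r ≤ 2 ^ (m + 1) * r ^ m * u r := by
  have hsh := h.shoot r ⟨hr, by linarith⟩
  obtain ⟨c, hc, he⟩ := hsh.exists_sub_eq le_rfl (show r < 2 * r by linarith) hrb.le
  have hc0 : 0 < c := hr.trans hc.1
  have h1 : - y r ≤ - y c :=
    neg_le_neg (h.antitone hl ⟨hr, by linarith⟩ ⟨hc0, by linarith [hc.2]⟩ hc.1.le)
  have h2 := h.pos (2 * r) ⟨by linarith, hrb⟩
  rcases le_total (- y r) 0 with h0 | h0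
  · have := h.pos r ⟨hr, by linarith⟩
    exact h0.trans (by positivity)
  have h4 : - y r / (2 * r) ^ (m + 1) * r ≤ - y c / c ^ (m + 1) * (2 * r - r) := by
    have h5 : c ^ (m + 1) ≤ (2 * r) ^ (m + 1) := pow_le_pow_left₀ hc0.le hc.2.le _
    have h6 : 0 ≤ - y c := h0.trans h1
    rw [show 2 * r - r = r by ring]
    gcongr
  rw [neg_div (c ^ (m + 1))] at h4
  have h7 : - y r / (2 * r) ^ (m + 1) * r ≤ u r := by linarith
  have h8 : - y r / (2 * r) ^ (m + 1) * r = - y r / (2 ^ (m + 1) * r ^ m) := by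
    rw [mul_pow, pow_succ r]; field_simp
  rw [h8, div_le_iff₀ (by positivity)] at h7
  linarith

end Entire

/-! ### Pohozaev and Hardy: no positive solutions of small flux. -/

section Pohozaev

variable {m : ℕ} {p lam b η : ℝ} {u y : ℝ → ℝ}

/-- The Pohozaev exponent defect, positive in the supercritical range. -/
noncomputable def pohozaevConst (m : ℕ) (p : ℝ) : ℝ := m / 2 - (m + 2) / (p + 1)

theorem pohozaevConst_pos (hm : 0 < m) (hp : ((m : ℝ) + 4) / m < p) : 0 < pohozaevConst m p := by
  have hm' : (0 : ℝ) < m := by exact_mod_cast hm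
  have hp0 : 0 < p := lt_trans (by positivity) hp
  rw [div_lt_iff₀ hm'] at hp
  unfold pohozaevConst
  rw [sub_pos, div_lt_div_iff₀ (by positivity) (by positivity)]
  linarith

/-- The energy `c u y` minus the Pohozaev functional. -/
noncomputable def pohozaevFun (m : ℕ) (p lam : ℝ) (u y : ℝ → ℝ) (r : ℝ) : ℝ :=
  pohozaevConst m p * (u r * y r) - y r ^ 2 / (2 * r ^ m) -
    r ^ (m + 2) * (lam * u r ^ 2 / 2 + u r ^ (p + 1) / (p + 1)) - m / 2 * (y r * u r)

/-- The weight `pohozaevConst` on the energy identity is the one that cancels `u ^ (p + 1)`, leaving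
a gradient term and a lower order term. -/
theorem IsEntire.hasDerivAt_pohozaevFun (h : IsEntire m p lam b η u y) (hp : 1 < p)
    {r : ℝ} (hr : r ∈ Ioo 0 b) :
    HasDerivAt (pohozaevFun m p lam u y)
      (pohozaevConst m p * (y r ^ 2 / r ^ (m + 1)) -
        (pohozaevConst m p + 1) * lam * (r ^ (m + 1) * u r ^ 2)) r := by
  have hr0 : 0 < r := hr.1
  have hur := h.pos r hr
  have du := h.du hr
  have dy := h.dy hr
  have h1 := (du.mul dy).const_mul (pohozaevConst m p)
  have h2 := (dy.pow 2).div ((hasDerivAt_pow m r).const_mul 2)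
    (show 2 * r ^ m ≠ 0 by positivity)
  have h3 := (hasDerivAt_pow (m + 2) r).mul ((((du.pow 2).const_mul lam).div_const 2).add
    ((du.rpow_const (p := p + 1) (Or.inl hur.ne')).div_const (p + 1)))
  have h4 := (dy.mul du).const_mul ((m : ℝ) / 2)
  have := ((h1.sub h2).sub h3).sub h4
  refine this.congr_deriv ?_
  have e1 : u r ^ (p + 1 - 1) = u r ^ p := by congr 1; ring
  have e2 : u r ^ (p + 1) = u r ^ p * u r := Real.rpow_add_one hur.ne' p
  have e3 : (m : ℝ) * r ^ (m - 1) = m * r ^ m / r := by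
    rcases Nat.eq_zero_or_pos m with rfl | hm
    · simp
    · obtain ⟨k, rfl⟩ : ∃ k, m = k + 1 := ⟨m - 1, by omega⟩
      simp only [Nat.add_sub_cancel, pow_succ]
      field_simp
  have hp1 : p + 1 ≠ 0 := by linarith
  simp only [e1, e2, e3, nonlin_of_pos hur, show m + 2 - 1 = m + 1 by omega, pohozaevConst,
    Pi.pow_apply, Pi.add_apply]
  push_cast
  field_simp
  ring

/-- Hardy's inequality in differential form: adding this turns the gradient term `y ^ 2` of the
Pohozaev identity into a perfect square. -/
theorem IsEntire.hasDerivAt_sq_mul_pow (h : IsEntire m p lam b η u y)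
    {r : ℝ} (hr : r ∈ Ioo 0 b) :
    HasDerivAt (fun r => m * (u r ^ 2 * r ^ m))
      (((y r + m * r ^ m * u r) ^ 2 - y r ^ 2) / r ^ (m + 1)) r := by
  have hr0 : 0 < r := hr.1
  have := (((h.du hr).pow 2).mul (hasDerivAt_pow m r)).const_mul (m : ℝ)
  refine this.congr_deriv ?_
  have e3 : (m : ℝ) * r ^ (m - 1) = m * r ^ m / r := by
    rcases Nat.eq_zero_or_pos m with rfl | hm
    · simp
    · obtain ⟨k, rfl⟩ : ∃ k, m = k + 1 := ⟨m - 1, by omega⟩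
      simp only [Nat.add_sub_cancel, pow_succ]
      field_simp
  simp only [e3, Pi.pow_apply]
  field_simp
  push_cast
  ring

/-- By the a priori bounds every negative term is at most a multiple of `u r ^ 2 * r ^ m`, so the
functional has no negative limit at the origin. -/
theorem IsEntire.pohozaevFun_lower (h : IsEntire m p lam b η u y) (hp : 1 < p) (hl : 0 < lam)
    (hm : 0 < m) (hc : 0 < pohozaevConst m p) {r : ℝ} (hr : 0 < r) (hrb : 2 * r < b) :
    -((pohozaevConst m p * 2 ^ (m + 1) + (2 ^ (m + 1)) ^ 2 / 2 + lam * b ^ 2 / 2 +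
      2 * (m + 2) / (p - 1) / (p + 1)) * (u r ^ 2 * r ^ m)) ≤ pohozaevFun m p lam u y r := by
  have hrI : r ∈ Ioo 0 b := ⟨hr, by linarith⟩
  have hur := h.pos r hrI
  have hy0 := h.flux_neg hl hm hrI
  have hy1 := h.neg_flux_le hl hr hrb
  have hs := h.sq_mul_rpow_le hp hl hm hrI
  set c := pohozaevConst m p with hcdef
  have e1 : -(c * 2 ^ (m + 1) * (u r ^ 2 * r ^ m)) ≤ c * (u r * y r) := by
    have := mul_le_mul_of_nonneg_left hy1 (show 0 ≤ c * u r by positivity)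
    linarith
  have e2 : y r ^ 2 / (2 * r ^ m) ≤ (2 ^ (m + 1)) ^ 2 / 2 * (u r ^ 2 * r ^ m) := by
    rw [div_le_iff₀ (by positivity)]
    have : (- y r) ^ 2 ≤ (2 ^ (m + 1) * r ^ m * u r) ^ 2 :=
      pow_le_pow_left₀ (by linarith) hy1 2
    calc y r ^ 2 = (- y r) ^ 2 := by ring
      _ ≤ _ := this
      _ = _ := by ring
  have e3 : r ^ (m + 2) * (lam * u r ^ 2 / 2) ≤ lam * b ^ 2 / 2 * (u r ^ 2 * r ^ m) := by
    have : r ^ 2 ≤ b ^ 2 := pow_le_pow_left₀ hr.le hrI.2.le 2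
    calc r ^ (m + 2) * (lam * u r ^ 2 / 2) = lam * r ^ 2 / 2 * (u r ^ 2 * r ^ m) := by ring
      _ ≤ _ := by gcongr
  have e4 : r ^ (m + 2) * (u r ^ (p + 1) / (p + 1)) ≤
      2 * (m + 2) / (p - 1) / (p + 1) * (u r ^ 2 * r ^ m) := by
    have e5 : u r ^ (p + 1) = u r ^ (p - 1) * u r ^ 2 := by
      rw [← Real.rpow_natCast (u r) 2, ← Real.rpow_add hur]; congr 1; push_cast; ring
    have hp0 : 0 < p + 1 := by linarith
    calc r ^ (m + 2) * (u r ^ (p + 1) / (p + 1)) =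
          (r ^ 2 * u r ^ (p - 1)) / (p + 1) * (u r ^ 2 * r ^ m) := by rw [e5]; ring
      _ ≤ _ := by gcongr
  have e6 : (m : ℝ) / 2 * (y r * u r) ≤ 0 :=
    mul_nonpos_of_nonneg_of_nonpos (by positivity) (mul_nonpos_of_nonpos_of_nonneg hy0.le hur.le)
  unfold pohozaevFun
  rw [← hcdef]
  linarith

/-- The Hardy type bound: up to a factor, the mass near the origin is controlled by the value at
a fixed point. -/
theorem IsEntire.sq_mul_pow_le_of_bound (h : IsEntire m p lam b η u y)
    (hp : ((m : ℝ) + 4) / m < p) (hl : 0 < lam) (hm : 0 < m)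
    {ε : ℝ} (hε : ε ∈ Ioo 0 b) {A : ℝ} (hA : ∀ r ∈ Ioc 0 ε, u r ^ 2 * r ^ m ≤ A)
    {r : ℝ} (hr : r ∈ Ioc 0 ε) :
    pohozaevConst m p * (m * (u r ^ 2 * r ^ m)) ≤
      (pohozaevConst m p + 1) * lam * (A * ε ^ 2 / 2 + u ε ^ 2 * b ^ (m + 2) / (m + 2)) := by
  have hm' : (0 : ℝ) < m := by exact_mod_cast hm
  have hp1 : 1 < p := by
    refine lt_trans ?_ hp
    rw [lt_div_iff₀ hm']; linarith
  have hc := pohozaevConst_pos hm hp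
  have hb : 0 < b := hε.1.trans hε.2
  set c := pohozaevConst m p with hcdef
  set Λ : ℝ := (c + 1) * lam with hΛ
  have hΛ0 : 0 < Λ := by positivity
  set Q := pohozaevFun m p lam u y with hQ
  have dQ : ∀ x ∈ Ioo 0 b, HasDerivAt Q
      (c * (y x ^ 2 / x ^ (m + 1)) - Λ * (x ^ (m + 1) * u x ^ 2)) x :=
    fun x hx => h.hasDerivAt_pohozaevFun hp1 hx
  have dR : ∀ x ∈ Ioo 0 b, HasDerivAt (fun x => c * (m * (u x ^ 2 * x ^ m)) + Q x)
      (c * ((y x + m * x ^ m * u x) ^ 2 / x ^ (m + 1)) - Λ * (x ^ (m + 1) * u x ^ 2)) x :=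
    fun x hx => (((h.hasDerivAt_sq_mul_pow hx).const_mul c).add (dQ x hx)).congr_deriv (by ring)
  have dA : ∀ x : ℝ, HasDerivAt (fun x => Λ * A * x ^ 2 / 2) (Λ * A * x) x := fun x =>
    (((hasDerivAt_pow 2 x).const_mul (Λ * A)).div_const 2).congr_deriv (by push_cast; ring)
  have hAx : ∀ x ∈ Ioc 0 ε, Λ * (x ^ (m + 1) * u x ^ 2) ≤ Λ * A * x := fun x hx => by
    have h1 := mul_le_mul_of_nonneg_left (hA x hx) (show 0 ≤ Λ * x by have := hx.1; positivity)
    calc _ = Λ * x * (u x ^ 2 * x ^ m) := by ring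
      _ ≤ _ := h1
      _ = _ := by ring
  have hrb : r < b := hr.2.trans_lt hε.2
  -- On `(0, r)` the Pohozaev functional alone is used, started from the origin. From `r` on, the
  -- Hardy term is added: up to `ε` the lower order term is controlled by `A`, beyond `ε` by `u ≤ u
  -- ε`, and at `b` the sum is nonpositive.
  have s1 : 0 ≤ Q r + Λ * A * r ^ 2 / 2 := by
    have hσ : 0 < m - 4 / (p - 1) := by
      rw [sub_pos, div_lt_iff₀ (by linarith)]
      rw [div_lt_iff₀ hm'] at hp
      linarith
    set D : ℝ := (c * 2 ^ (m + 1) + (2 ^ (m + 1)) ^ 2 / 2 + lam * b ^ 2 / 2 +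
      2 * (m + 2) / (p - 1) / (p + 1)) with hD
    have hD0 : 0 ≤ D := by
      have : 0 < p - 1 := by linarith
      have : 0 < p + 1 := by linarith
      positivity
    set κ : ℝ := (2 * (m + 2) / (p - 1)) ^ (2 / (p - 1)) with hκ
    have hbd : ∀ s ∈ Ioo 0 (r / 2),
        -(D * (κ * s ^ ((m : ℝ) - 4 / (p - 1)))) ≤ Q r + Λ * A * r ^ 2 / 2 - Λ * A * s ^ 2 / 2 := by
      intro s hs
      have hs0 : 0 < s := hs.1
      have hsr : s < r := by linarith [hs.2]
      have hsub : Icc s r ⊆ Ioo 0 b := fun x hx => ⟨hs0.trans_le hx.1, hx.2.trans_lt hrb⟩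
      have hmono := monotoneOn_Icc_of_hasDerivAt_nonneg
        (f := fun x => Q x + Λ * A * x ^ 2 / 2)
        (fun x hx => ((dQ x (hsub hx)).add (dA x)).continuousAt.continuousWithinAt)
        (fun x hx => (dQ x (hsub (Ioo_subset_Icc_self hx))).add (dA x)) fun x hx => by
          have hx0 : 0 < x := hs0.trans hx.1
          have h1 := hAx x ⟨hx0, hx.2.le.trans hr.2⟩
          have : 0 ≤ c * (y x ^ 2 / x ^ (m + 1)) := by positivity
          linarith
      have h1 := hmono ⟨le_rfl, hsr.le⟩ ⟨hsr.le, le_rfl⟩ hsr.le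
      simp only at h1
      have h2 : -(D * (u s ^ 2 * s ^ m)) ≤ Q s :=
        h.pohozaevFun_lower hp1 hl hm hc hs0 (by linarith [hs.2])
      have h3 := h.pow_mul_sq_le hp1 hl hm (hsub ⟨le_rfl, hsr.le⟩)
      have h4 := mul_le_mul_of_nonneg_left h3 hD0
      linarith
    have hlim : Tendsto (fun s : ℝ => -(D * (κ * s ^ ((m : ℝ) - 4 / (p - 1)))) +
        Λ * A * s ^ 2 / 2) (𝓝[>] 0) (𝓝 0) := by
      have h1 : Continuous (fun s : ℝ => -(D * (κ * s ^ ((m : ℝ) - 4 / (p - 1)))) +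
          Λ * A * s ^ 2 / 2) := by
        have : Continuous fun s : ℝ => s ^ ((m : ℝ) - 4 / (p - 1)) :=
          Real.continuous_rpow_const hσ.le
        fun_prop
      have h2 := h1.tendsto 0
      simp only [Real.zero_rpow hσ.ne'] at h2
      norm_num at h2
      exact h2.mono_left nhdsWithin_le_nhds
    refine le_of_tendsto hlim ?_
    filter_upwards [Ioo_mem_nhdsGT (show (0:ℝ) < r / 2 by linarith [hr.1])] with s hs
    linarith [hbd s hs]
  have s2 : c * (m * (u r ^ 2 * r ^ m)) + Q r + Λ * A * r ^ 2 / 2 ≤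
      c * (m * (u ε ^ 2 * ε ^ m)) + Q ε + Λ * A * ε ^ 2 / 2 := by
    have hsub : Icc r ε ⊆ Ioo 0 b := fun x hx => ⟨hr.1.trans_le hx.1, hx.2.trans_lt hε.2⟩
    exact monotoneOn_Icc_of_hasDerivAt_nonneg
        (f := fun x => c * (m * (u x ^ 2 * x ^ m)) + Q x + Λ * A * x ^ 2 / 2)
        (fun x hx => ((dR x (hsub hx)).add (dA x)).continuousAt.continuousWithinAt)
        (fun x hx => (dR x (hsub (Ioo_subset_Icc_self hx))).add (dA x)) (fun x hx => by
          have hx0 : 0 < x := hr.1.trans hx.1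
          have h1 := hAx x ⟨hx0, hx.2.le⟩
          have : 0 ≤ c * ((y x + m * x ^ m * u x) ^ 2 / x ^ (m + 1)) := by positivity
          linarith) ⟨le_rfl, hr.2⟩ ⟨hr.2, le_rfl⟩ hr.2
  have s3 : c * (m * (u ε ^ 2 * ε ^ m)) + Q ε + Λ * u ε ^ 2 * ε ^ (m + 2) / (m + 2) ≤
      c * (m * (u b ^ 2 * b ^ m)) + Q b + Λ * u ε ^ 2 * b ^ (m + 2) / (m + 2) := by
    have hsh := h.shoot ε hε
    have dB : ∀ x : ℝ, HasDerivAt (fun x => Λ * u ε ^ 2 * x ^ (m + 2) / (m + 2))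
        (Λ * u ε ^ 2 * x ^ (m + 1)) x := fun x =>
      (((hasDerivAt_pow (m + 2) x).const_mul (Λ * u ε ^ 2)).div_const ((m : ℝ) + 2)).congr_deriv
        (by have : (m : ℝ) + 2 ≠ 0 := by positivity
            push_cast
            field_simp)
    refine monotoneOn_Icc_of_hasDerivAt_nonneg
        (f := fun x => c * (m * (u x ^ 2 * x ^ m)) + Q x + Λ * u ε ^ 2 * x ^ (m + 2) / (m + 2))
        ?_ (fun x hx => (dR x ⟨hε.1.trans hx.1, hx.2⟩).add (dB x)) (fun x hx => ?_)
        ⟨le_rfl, hε.2.le⟩ ⟨hε.2.le, le_rfl⟩ hε.2.le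
    · have hcu := hsh.contu
      have hcy := hsh.conty
      have hcQ : ContinuousOn Q (Icc ε b) := by
        rw [hQ]; unfold pohozaevFun
        have h1 : ContinuousOn (fun x => u x ^ (p + 1)) (Icc ε b) :=
          hcu.rpow_const fun x _ => Or.inr (by linarith)
        have h2 : ContinuousOn (fun x => y x ^ 2 / (2 * x ^ m)) (Icc ε b) :=
          (hcy.pow 2).div (by fun_prop) fun x hx => by
            have := hε.1.trans_le hx.1; positivity
        fun_prop
      fun_prop
    · have hx0 : 0 < x := hε.1.trans hx.1
      have h1 : u x ≤ u ε := h.u_antitone hl hm ⟨hε.1, hε.2.le⟩ ⟨hx0, hx.2.le⟩ hx.1.le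
      have h2 : u x ^ 2 ≤ u ε ^ 2 := pow_le_pow_left₀ (h.pos x ⟨hx0, hx.2⟩).le h1 2
      have h3 : Λ * (x ^ (m + 1) * u x ^ 2) ≤ Λ * (x ^ (m + 1) * u ε ^ 2) := by gcongr
      have : 0 ≤ c * ((y x + m * x ^ m * u x) ^ 2 / x ^ (m + 1)) := by positivity
      linarith
  have s4 : c * (m * (u b ^ 2 * b ^ m)) + Q b ≤ 0 := by
    rw [hQ]; unfold pohozaevFun
    rw [(h.shoot ε hε).ub, Real.zero_rpow (by linarith)]
    have : 0 ≤ y b ^ 2 / (2 * b ^ m) := by positivity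
    simp only [mul_zero, zero_mul, zero_div, add_zero, ne_eq, OfNat.ofNat_ne_zero,
      not_false_eq_true, zero_pow]
    linarith
  have s5 : 0 ≤ Λ * u ε ^ 2 * ε ^ (m + 2) / (m + 2) := by have := hε.1; positivity
  have : Λ * (A * ε ^ 2 / 2 + u ε ^ 2 * b ^ (m + 2) / (m + 2)) =
    Λ * A * ε ^ 2 / 2 + Λ * u ε ^ 2 * b ^ (m + 2) / (m + 2) := by ring
  rw [this]
  linarith

/-- Take `A` to be the supremum of the left side over `(0, ε]` and absorb the term in `A`. The
universal bound makes this supremum finite. -/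
theorem exists_forall_entire_sq_mul_pow_le (hp : ((m : ℝ) + 4) / m < p) (hl : 0 < lam)
    (hm : 0 < m) (hb : 0 < b) :
    ∃ ε ∈ Ioo 0 (b / 2), ∃ C > 0, ∀ η u y, IsEntire m p lam b η u y →
      ∀ r ∈ Ioc 0 ε, u r ^ 2 * r ^ m ≤ C * u ε ^ 2 := by
  have hm' : (0 : ℝ) < m := by exact_mod_cast hm
  have hp1 : 1 < p := by
    refine lt_trans ?_ hp
    rw [lt_div_iff₀ hm']; linarith
  have hc := pohozaevConst_pos hm hp
  set c := pohozaevConst m p with hcdef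
  set Λ : ℝ := (c + 1) * lam with hΛ
  have hΛ0 : 0 < Λ := by positivity
  -- This gives `Λ * ε ^ 2 ≤ c * m`, so the term `Λ * A * ε ^ 2 / 2` is at most half of `c * m * A`.
  set ε : ℝ := min (b / 4) (min 1 (c * m / Λ)) with hεdef
  have hε0 : 0 < ε := by
    have : 0 < c * m / Λ := by positivity
    have : 0 < b / 4 := by positivity
    simp only [hεdef, lt_min_iff]
    exact ⟨by assumption, by norm_num, by assumption⟩
  have hε1 : Λ * ε ^ 2 ≤ c * m := by
    have h1 : ε ≤ 1 := (min_le_right _ _).trans (min_le_left _ _)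
    have h2 : ε ≤ c * m / Λ := (min_le_right _ _).trans (min_le_right _ _)
    rw [le_div_iff₀ hΛ0] at h2
    have h3 : ε ^ 2 ≤ ε := by rw [sq]; exact mul_le_of_le_one_left hε0.le h1
    calc Λ * ε ^ 2 ≤ Λ * ε := by gcongr
      _ ≤ _ := by linarith
  have hε2 : ε < b / 2 := (min_le_left _ _).trans_lt (by linarith)
  refine ⟨ε, ⟨hε0, hε2⟩, 2 * Λ * b ^ (m + 2) / (m + 2) / (c * m), by positivity,
    fun η u y h => ?_⟩
  have hεI : ε ∈ Ioo 0 b := ⟨hε0, by linarith⟩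
  have hσ : 0 < m - 4 / (p - 1) := by
    rw [sub_pos, div_lt_iff₀ (by linarith)]
    rw [div_lt_iff₀ hm'] at hp
    linarith
  set S : Set ℝ := (fun r => u r ^ 2 * r ^ m) '' Ioc 0 ε with hS
  have hne : S.Nonempty := ⟨_, ε, ⟨hε0, le_rfl⟩, rfl⟩
  have hbdd : BddAbove S := by
    refine ⟨(2 * (m + 2) / (p - 1)) ^ (2 / (p - 1)) * b ^ ((m : ℝ) - 4 / (p - 1)), ?_⟩
    rintro _ ⟨r, hr, rfl⟩
    have hrI : r ∈ Ioo 0 b := ⟨hr.1, hr.2.trans_lt hεI.2⟩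
    refine (h.pow_mul_sq_le hp1 hl hm hrI).trans ?_
    have : 0 < p - 1 := by linarith
    have := Real.rpow_le_rpow hr.1.le hrI.2.le hσ.le
    gcongr
  have hA : ∀ r ∈ Ioc 0 ε, u r ^ 2 * r ^ m ≤ sSup S := fun r hr =>
    le_csSup hbdd ⟨r, hr, rfl⟩
  have hA0 : 0 ≤ sSup S := le_trans (by positivity) (hA ε ⟨hε0, le_rfl⟩)
  have hsup : sSup S ≤ Λ * (sSup S * ε ^ 2 / 2 + u ε ^ 2 * b ^ (m + 2) / (m + 2)) / (c * m) := by
    refine csSup_le hne ?_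
    rintro _ ⟨r, hr, rfl⟩
    rw [le_div_iff₀ (by positivity)]
    have := h.sq_mul_pow_le_of_bound hp hl hm hεI hA hr
    rw [← hcdef, ← hΛ] at this
    linarith
  rw [le_div_iff₀ (by positivity)] at hsup
  have h1 := mul_le_mul_of_nonneg_left hε1 hA0
  intro r hr
  refine (hA r hr).trans ?_
  rw [div_mul_eq_mul_div, le_div_iff₀ (by positivity)]
  have h2 : 2 * Λ * b ^ (m + 2) / (m + 2) * u ε ^ 2 =
    2 * (Λ * (u ε ^ 2 * b ^ (m + 2) / (m + 2))) := by ring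
  rw [h2]
  linarith

/-- There are no positive solutions on the punctured ball with small boundary flux, if there is
a bounded one. -/
theorem exists_forall_small_not_entire (hp : ((m : ℝ) + 4) / m < p) (hl : 0 < lam)
    (hm : 0 < m) (hb : 0 < b) {η' : ℝ} {v z : ℝ → ℝ} (h' : IsEntire m p lam b η' v z)
    {B : ℝ} (hB : ∀ r ∈ Ioo 0 b, v r ≤ B) :
    ∃ e > 0, ∀ η u y, η < e → ¬ IsEntire m p lam b η u y := by
  have hm' : (0 : ℝ) < m := by exact_mod_cast hm
  have hp1 : 1 < p := by
    refine lt_trans ?_ hp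
    rw [lt_div_iff₀ hm']; linarith
  obtain ⟨ε, hε, C, hC0, hC⟩ := exists_forall_entire_sq_mul_pow_le hp hl hm hb
  have hε0 : 0 < ε := hε.1
  have hεI : ε ∈ Ioo 0 b := ⟨hε.1, by linarith [hε.2]⟩
  have hvε := h'.pos ε hεI
  have hB0 : 0 < B := hvε.trans_le (hB ε hεI)
  have hθ : (1 / 2 : ℝ) ^ (p - 1) < 1 :=
    Real.rpow_lt_one (by norm_num) (by norm_num) (by linarith)
  set θ : ℝ := 1 - (1 / 2 : ℝ) ^ (p - 1) with hθd
  have hθ0 : 0 < θ := by linarith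
  set k : ℝ := (ε / 2) ^ (m + 1) * v ε * (θ * v ε ^ (p - 1)) * (ε / 2) with hk
  have hk0 : 0 < k := by positivity
  -- The final estimates are `k * u ε ≤ -y δ * B` and `(-y δ) ^ 2 ≤ (2 ^ (m + 1)) ^ 2 * C * δ ^ m *
  -- u ε ^ 2`. Both scale alike in `u ε`, so `δ` can be chosen before `u`.
  obtain ⟨δ, hδ, hδk⟩ : ∃ δ ∈ Ioo 0 (ε / 2), (2 ^ (m + 1)) ^ 2 * C * B ^ 2 * δ ^ m < k ^ 2 := by
    by_contra! hcon
    have := le_of_forall_small_le hm (half_pos hε0) hcon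
    have : 0 < k ^ 2 := by positivity
    linarith
  have hδ0 : 0 < δ := hδ.1
  have hδε : δ < ε / 2 := hδ.2
  have hδI : δ ∈ Ioo 0 b := ⟨hδ.1, by linarith [hε.2]⟩
  have hzδ := h'.flux_neg hl hm hδI
  -- This threshold forces `u ≤ v / 2` on `(δ, b)`, which leaves a definite gain in the Wronskian on
  -- `[ε / 2, ε]`.
  refine ⟨δ ^ (m + 1) * (- z δ / (2 * b ^ (m + 1))), ?_, fun η u y hηe h => ?_⟩
  · have : 0 < - z δ := by linarith
    positivity
  have hη := h.eta_pos hl hm hb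
  have hsh := h.shoot δ hδI
  have hsh' := h'.shoot δ hδI
  have hlt : ∀ r ∈ Ioo δ b, u r ≤ 1 / 2 * v r := fun r hr => by
    have h1 := hsh.le_mul_sub hl hδ0 hη.le (Ioo_subset_Icc_self hr)
    have h2 := hsh'.mul_sub_le hl hδ0 hzδ.le (Ioo_subset_Icc_self hr)
    have h3 : η / δ ^ (m + 1) ≤ 1 / 2 * (- z δ / b ^ (m + 1)) := by
      rw [div_le_iff₀ (by positivity)]
      refine hηe.le.trans (le_of_eq ?_)
      field_simp
    have h4 := mul_le_mul_of_nonneg_right h3 (show 0 ≤ b - r by linarith [hr.2])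
    linarith
  have hpow : ∀ r ∈ Ioo δ b, θ * v r ^ (p - 1) ≤ v r ^ (p - 1) - u r ^ (p - 1) := fun r hr => by
    have hrI : r ∈ Ioo 0 b := ⟨hδ0.trans hr.1, hr.2⟩
    have h1 := Real.rpow_le_rpow (h.pos r hrI).le (hlt r hr) (show 0 ≤ p - 1 by linarith)
    rw [Real.mul_rpow (by norm_num) (h'.pos r hrI).le] at h1
    rw [hθd]; linarith
  have hWc : ContinuousOn (fun r => y r * v r - u r * z r) (Icc δ b) :=
    (hsh.conty.mul hsh'.contu).sub (hsh.contu.mul hsh'.conty)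
  have hWd : ∀ r ∈ Ioo δ b, HasDerivAt (fun r => y r * v r - u r * z r)
      (r ^ (m + 1) * (u r * v r) * (v r ^ (p - 1) - u r ^ (p - 1))) r := fun r hr =>
    hsh.wronskian_hasDerivAt hsh' hδ0 hr (h.pos r ⟨hδ0.trans hr.1, hr.2⟩)
      (h'.pos r ⟨hδ0.trans hr.1, hr.2⟩)
  have hmono := monotoneOn_Icc_of_hasDerivAt_nonneg hWc hWd fun r hr => by
    have hrI : r ∈ Ioo 0 b := ⟨hδ0.trans hr.1, hr.2⟩
    have h1 := hpow r hr
    have h2 := h.pos r hrI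
    have h3 := h'.pos r hrI
    have hr0 : 0 < r := hrI.1
    exact mul_nonneg (by positivity) (le_trans (by positivity) h1)
  have w1 : y ε * v ε - u ε * z ε ≤ y b * v b - u b * z b :=
    hmono ⟨by linarith, hεI.2.le⟩ ⟨hδI.2.le, le_rfl⟩ hεI.2.le
  have w2 : y δ * v δ - u δ * z δ ≤ y (ε / 2) * v (ε / 2) - u (ε / 2) * z (ε / 2) :=
    hmono ⟨le_rfl, hδI.2.le⟩ ⟨hδε.le, by linarith [hε.2]⟩ hδε.le
  rw [hsh.ub, hsh'.ub] at w1
  obtain ⟨x, hx, hxe⟩ := exists_sub_eq_mul_of_hasDerivAt (half_lt_self hε0)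
    (hWc.mono (Icc_subset_Icc hδε.le hεI.2.le))
    (fun r hr => hWd r ⟨hδε.trans hr.1, hr.2.trans hεI.2⟩)
  have hx0 : 0 < x := (half_pos hε0).trans hx.1
  have hxI : x ∈ Ioo 0 b := ⟨hx0, hx.2.trans hεI.2⟩
  have huε := h.pos ε hεI
  have w3 : k * u ε ≤ x ^ (m + 1) * (u x * v x) * (v x ^ (p - 1) - u x ^ (p - 1)) *
      (ε - ε / 2) := by
    have h1 := hpow x ⟨hδε.trans hx.1, hxI.2⟩
    have h2 : u ε ≤ u x := h.u_antitone hl hm ⟨hx0, hxI.2.le⟩ ⟨hε0, hεI.2.le⟩ hx.2.le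
    have h3 : v ε ≤ v x := h'.u_antitone hl hm ⟨hx0, hxI.2.le⟩ ⟨hε0, hεI.2.le⟩ hx.2.le
    have h4 : v ε ^ (p - 1) ≤ v x ^ (p - 1) := Real.rpow_le_rpow hvε.le h3 (by linarith)
    have h5 : (ε / 2) ^ (m + 1) ≤ x ^ (m + 1) := pow_le_pow_left₀ (by positivity) hx.1.le _
    have hux := h.pos x hxI
    have hvx := h'.pos x hxI
    calc k * u ε = (ε / 2) ^ (m + 1) * (u ε * v ε) * (θ * v ε ^ (p - 1)) * (ε / 2) := by
          rw [hk]; ring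
      _ ≤ x ^ (m + 1) * (u x * v x) * (θ * v x ^ (p - 1)) * (ε / 2) := by gcongr
      _ ≤ x ^ (m + 1) * (u x * v x) * (v x ^ (p - 1) - u x ^ (p - 1)) * (ε / 2) := by gcongr
      _ = _ := by ring
  have w4 : 0 ≤ - (u δ * z δ) := by
    have := mul_nonneg (h.pos δ hδI).le (neg_nonneg.2 hzδ.le)
    linarith
  have hyδ := h.flux_neg hl hm hδI
  have w5 : k * u ε ≤ - y δ * B := by
    have h1 : - y δ * v δ ≤ - y δ * B :=
      mul_le_mul_of_nonneg_left (hB δ hδI) (by linarith)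
    linarith
  have w6 : (- y δ) ^ 2 ≤ (2 ^ (m + 1)) ^ 2 * C * δ ^ m * u ε ^ 2 := by
    have h1 := h.neg_flux_le hl hδ0 (by linarith [hε.2])
    have h2 := hC η u y h δ ⟨hδ0, by linarith⟩
    calc (- y δ) ^ 2 ≤ (2 ^ (m + 1) * δ ^ m * u δ) ^ 2 :=
          pow_le_pow_left₀ (by linarith) h1 2
      _ = (2 ^ (m + 1)) ^ 2 * δ ^ m * (u δ ^ 2 * δ ^ m) := by ring
      _ ≤ (2 ^ (m + 1)) ^ 2 * δ ^ m * (C * u ε ^ 2) := by gcongr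
      _ = _ := by ring
  have w7 : (k * u ε) ^ 2 ≤ (- y δ * B) ^ 2 := pow_le_pow_left₀ (by positivity) w5 2
  have w8 : (k * u ε) ^ 2 ≤ (2 ^ (m + 1)) ^ 2 * C * B ^ 2 * δ ^ m * u ε ^ 2 := by
    refine w7.trans ?_
    calc (- y δ * B) ^ 2 = (- y δ) ^ 2 * B ^ 2 := by ring
      _ ≤ ((2 ^ (m + 1)) ^ 2 * C * δ ^ m * u ε ^ 2) * B ^ 2 := by gcongr
      _ = _ := by ring
  have w9 := mul_lt_mul_of_pos_right hδk (show 0 < u ε ^ 2 by positivity)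
  rw [mul_pow] at w8
  linarith

end Pohozaev

/-! ### Passage between classical and shooting solutions. -/

section Classical

variable {m : ℕ} {p lam a b η : ℝ} {u y : ℝ → ℝ}

theorem IsPositiveBallSolution.exists_isEntire (hp : 1 < p) (hl : 0 < lam) (hb : 0 < b)
    (h : IsPositiveBallSolution (m + 2) p lam b u) :
    ∃ η y, IsEntire m p lam b η u y := by
  obtain ⟨⟨hC, hpos, heq⟩, hcont, -, hub⟩ := h
  rw [show (2 : WithTop ℕ∞) = 1 + 1 by norm_num, contDiffOn_succ_iff_deriv_of_isOpen isOpen_Ioo]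
    at hC
  obtain ⟨hd1, -, hC1⟩ := hC
  have hd2 : DifferentiableOn ℝ (deriv u) (Ioo 0 b) := hC1.differentiableOn (by norm_num)
  have du : ∀ r ∈ Ioo 0 b, HasDerivAt u (deriv u r) r := fun r hr =>
    ((hd1 r hr).differentiableAt (isOpen_Ioo.mem_nhds hr)).hasDerivAt
  have ddu : ∀ r ∈ Ioo 0 b, HasDerivAt (deriv u) (deriv (deriv u) r) r := fun r hr =>
    ((hd2 r hr).differentiableAt (isOpen_Ioo.mem_nhds hr)).hasDerivAt
  set y₀ : ℝ → ℝ := fun r => r ^ (m + 1) * deriv u r with hy₀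
  have dy₀ : ∀ r ∈ Ioo 0 b, HasDerivAt y₀ (-(r ^ (m + 1) * nonlin p lam (u r))) r := by
    intro r hr
    have hr0 : 0 < r := hr.1
    refine ((hasDerivAt_pow (m + 1) r).mul (ddu r hr)).congr_deriv ?_
    rw [nonlin_of_pos (hpos r hr)]
    have h1 := heq r hr
    have h2 : deriv (deriv u) r = -(((m + 2 : ℕ) : ℝ) - 1) / r * deriv u r -
        (lam * u r + u r ^ p) := by rw [neg_div]; linarith
    rw [h2]
    push_cast
    field_simp
    ring
  set t : ℝ := b / 2 with ht
  have ht0 : 0 < t := by rw [ht]; linarith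
  have htb : t < b := by rw [ht]; linarith
  obtain ⟨B, hB⟩ := isCompact_Icc.exists_bound_of_continuousOn hcont
  -- No derivative is given at `b`, but the flux is monotone and bounded below near `b`, so it has a
  -- limit, which serves as its value there.
  have hanti : AntitoneOn y₀ (Ioo t b) := by
    intro r hr s hs hrs
    refine antitoneOn_Icc_of_hasDerivAt_nonpos (f := y₀)
      (fun x hx => (dy₀ x ⟨ht0.trans (hr.1.trans_le hx.1),
        hx.2.trans_lt hs.2⟩).continuousAt.continuousWithinAt)
      (fun x hx => dy₀ x ⟨ht0.trans (hr.1.trans hx.1), hx.2.trans hs.2⟩) (fun x hx => ?_)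
      ⟨le_rfl, hrs⟩ ⟨hrs, le_rfl⟩ hrs
    have hx0 : 0 < x := ht0.trans (hr.1.trans hx.1)
    have := nonlin_nonneg (p := p) hl (u x)
    have : 0 ≤ x ^ (m + 1) * nonlin p lam (u x) := by positivity
    linarith
  have hbdd : BddBelow (y₀ '' Ioo t b) := by
    refine ⟨y₀ t - b ^ (m + 1) * nonlin p lam B * b, ?_⟩
    rintro _ ⟨r, hr, rfl⟩
    obtain ⟨c, hc, he⟩ := exists_sub_eq_mul_of_hasDerivAt (f := y₀) hr.1
      (fun x hx => (dy₀ x ⟨ht0.trans_le hx.1, hx.2.trans_lt hr.2⟩).continuousAt.continuousWithinAt)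
      (fun x hx => dy₀ x ⟨ht0.trans hx.1, hx.2.trans hr.2⟩)
    have hc0 : 0 < c := ht0.trans hc.1
    have h1 : nonlin p lam (u c) ≤ nonlin p lam B := nonlin_mono hp hl <|
      (le_abs_self _).trans (hB c ⟨hc0.le, (hc.2.trans hr.2).le⟩)
    have h2 : c ^ (m + 1) ≤ b ^ (m + 1) := pow_le_pow_left₀ hc0.le (hc.2.trans hr.2).le _
    have h3 := nonlin_nonneg (p := p) hl (u c)
    have h4 : c ^ (m + 1) * nonlin p lam (u c) * (r - t) ≤
        b ^ (m + 1) * nonlin p lam B * b := by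
      have h5 : 0 ≤ r - t := by linarith [hr.1]
      have h6 : r - t ≤ b := by linarith [hr.2]
      have h7 := h3.trans h1
      gcongr
    linarith
  have hlim := hanti.tendsto_nhdsWithin_Ioo_left (nonempty_Ioo.2 htb) hbdd
  set l : ℝ := sInf (y₀ '' Ioo t b) with hl'
  set y : ℝ → ℝ := fun r => if r < b then y₀ r else l with hy
  have hyeq : ∀ r < b, y r = y₀ r := fun r hr => if_pos hr
  have hyev : ∀ r < b, y =ᶠ[𝓝 r] y₀ := fun r hr => by
    filter_upwards [Iio_mem_nhds hr] with x hx using hyeq x hx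
  refine ⟨-l, y, fun a ha => ⟨hcont.mono (Icc_subset_Icc_left ha.1.le), fun r hr => ?_,
    fun r hr => ?_, fun r hr => ?_, hub, by simp [hy]⟩, hpos⟩
  · rcases hr.2.lt_or_eq with h1 | rfl
    · exact ((dy₀ r ⟨ha.1.trans_le hr.1, h1⟩).continuousAt.congr
        (hyev r h1).symm).continuousWithinAt
    · have hyr : y r = l := if_neg (lt_irrefl r)
      refine ContinuousWithinAt.mono (t := Iic r) ?_ Icc_subset_Iic_self
      rw [← continuousWithinAt_Iio_iff_Iic]
      show Tendsto y (𝓝[<] r) (𝓝 (y r))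
      rw [hyr]
      refine hlim.congr' ?_
      filter_upwards [self_mem_nhdsWithin] with x hx using (hyeq x hx).symm
  · have hr0 : 0 < r := ha.1.trans hr.1
    refine (du r ⟨hr0, hr.2⟩).congr_deriv ?_
    rw [hyeq r hr.2, hy₀]
    field_simp
  · exact (dy₀ r ⟨ha.1.trans hr.1, hr.2⟩).congr_of_eventuallyEq (hyev r hr.2)

theorem IsShooting.isPositiveAnnulusSolution (h : IsShooting m p lam a b η u y) (hp : 1 < p)
    (hl : 0 < lam) (ha : 0 < a) (hη : 0 < η) (hua : u a = 0) :
    IsPositiveAnnulusSolution (m + 2) p lam a b u := by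
  have hpos : ∀ r ∈ Ioo a b, 0 < u r := fun r hr => h.pos_of_nonneg_left hl ha hη hua.ge hr
  have hdu : ∀ r ∈ Ioo a b, deriv u r = y r / r ^ (m + 1) := fun r hr => (h.du r hr).deriv
  have hev : ∀ r ∈ Ioo a b, deriv u =ᶠ[𝓝 r] fun r => y r / r ^ (m + 1) := fun r hr => by
    filter_upwards [isOpen_Ioo.mem_nhds hr] with x hx using hdu x hx
  have hddu : ∀ r ∈ Ioo a b, HasDerivAt (deriv u)
      (-(m + 1) / r * (y r / r ^ (m + 1)) - nonlin p lam (u r)) r := fun r hr => by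
    have hr0 : 0 < r := ha.trans hr.1
    refine HasDerivAt.congr_of_eventuallyEq ?_ (hev r hr)
    refine ((h.dy r hr).div (hasDerivAt_pow (m + 1) r) (by positivity)).congr_deriv ?_
    push_cast
    field_simp
    ring
  refine ⟨⟨?_, hpos, fun r hr => ?_⟩, h.contu, hua, h.ub⟩
  · rw [show (2 : WithTop ℕ∞) = 1 + 1 by norm_num, contDiffOn_succ_iff_deriv_of_isOpen isOpen_Ioo]
    refine ⟨fun r hr => (h.du r hr).differentiableAt.differentiableWithinAt, by simp, ?_⟩
    rw [show (1 : WithTop ℕ∞) = 0 + 1 by norm_num, contDiffOn_succ_iff_deriv_of_isOpen isOpen_Ioo]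
    refine ⟨fun r hr => (hddu r hr).differentiableAt.differentiableWithinAt, by simp, ?_⟩
    rw [contDiffOn_zero]
    have hcu := h.contu.mono Ioo_subset_Icc_self
    have hcy := h.conty.mono Ioo_subset_Icc_self
    have hcn := (nonlin_continuous (lam := lam) hp).comp_continuousOn hcu
    have h1 : ContinuousOn (fun r => -((m : ℝ) + 1) / r * (y r / r ^ (m + 1)) -
        nonlin p lam (u r)) (Ioo a b) := by
      refine ((continuousOn_const.div continuousOn_id fun x hx => ?_).mul
        (hcy.div (by fun_prop) fun x hx => ?_)).sub hcn
      · exact (ha.trans hx.1).ne'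
      · have := ha.trans hx.1; positivity
    exact h1.congr fun r hr => (hddu r hr).deriv
  · rw [(hddu r hr).deriv, hdu r hr, nonlin_of_pos (hpos r hr)]
    push_cast
    ring

theorem IsShooting.congr {u' y' : ℝ → ℝ} (h : IsShooting m p lam a b η u y) (hab : a ≤ b)
    (hu : EqOn u' u (Icc a b)) (hy : EqOn y' y (Icc a b)) :
    IsShooting m p lam a b η u' y' := by
  have hb : b ∈ Icc a b := ⟨hab, le_rfl⟩
  refine ⟨h.contu.congr hu, h.conty.congr hy, fun r hr => ?_, fun r hr => ?_,
    (hu hb).trans h.ub, (hy hb).trans h.yb⟩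
  · rw [hy (Ioo_subset_Icc_self hr)]
    refine (h.du r hr).congr_of_eventuallyEq ?_
    filter_upwards [Icc_mem_nhds hr.1 hr.2] with x hx using hu hx
  · rw [hu (Ioo_subset_Icc_self hr)]
    refine (h.dy r hr).congr_of_eventuallyEq ?_
    filter_upwards [Icc_mem_nhds hr.1 hr.2] with x hx using hy hx

theorem IsShooting.eta_eq {η' : ℝ} {u' y' : ℝ → ℝ} (h : IsShooting m p lam a b η u y)
    (h' : IsShooting m p lam a b η' u' y') (ha : 0 < a) (hab : a < b)
    (hu : EqOn u u' (Icc a b)) : η = η' := by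
  have hy : ∀ r ∈ Ioo a b, y r = y' r := fun r hr => by
    have h1 : HasDerivAt u (y' r / r ^ (m + 1)) r := (h'.du r hr).congr_of_eventuallyEq <| by
      filter_upwards [Icc_mem_nhds hr.1 hr.2] with x hx using hu hx
    have h2 := (h.du r hr).unique h1
    have hr0 : 0 < r := ha.trans hr.1
    exact (div_left_inj' (by positivity)).1 h2
  have hb : b ∈ Icc a b := ⟨hab.le, le_rfl⟩
  have h1 : Tendsto y (𝓝[Ioo a b] b) (𝓝 (y b)) := (h.conty b hb).mono Ioo_subset_Icc_self
  have h2 : Tendsto y' (𝓝[Ioo a b] b) (𝓝 (y' b)) := (h'.conty b hb).mono Ioo_subset_Icc_self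
  rw [nhdsWithin_Ioo_eq_nhdsLT hab] at h1 h2
  have h3 := tendsto_nhds_unique h1 (h2.congr' (by
    filter_upwards [Ioo_mem_nhdsLT hab] with x hx using (hy x hx).symm))
  rw [h.yb, h'.yb] at h3
  linarith

/-- Solutions on the intervals `[a, b]` agree by uniqueness and glue together. The value at `r` is
read off the solution on `[r / 2, b]`. -/
theorem exists_isEntire_of_forall_nonneg (hp : 1 < p) (hl : 0 < lam) (hη : 0 < η)
    (h : ∀ a ∈ Ioo 0 b, ∀ u y, IsShooting m p lam a b η u y → 0 ≤ u a) :
    ∃ u y, IsEntire m p lam b η u y := by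
  have hex : ∀ a : ℝ, ∃ u y, a ∈ Ioo 0 b → IsShooting m p lam a b η u y := fun a => by
    by_cases ha : a ∈ Ioo 0 b
    · obtain ⟨U, Y, hUY, -⟩ := exists_shooting_family m hp hl ha.1 ha.2 hη
      exact ⟨U η, Y η, fun _ => hUY η ⟨hη.le, le_rfl⟩⟩
    · exact ⟨0, 0, fun h => absurd h ha⟩
  choose U Y hUY using hex
  have hshoot : ∀ a ∈ Ioo 0 b,
      IsShooting m p lam a b η (fun r => U (r / 2) r) (fun r => Y (r / 2) r) := by
    intro a ha
    have ha0 : 0 < a := ha.1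
    have h1 := hUY (a / 2) ⟨by linarith, by linarith [ha.2]⟩
    have key : ∀ r ∈ Icc a b, U (r / 2) r = U (a / 2) r ∧ Y (r / 2) r = Y (a / 2) r := by
      intro r hr
      have hr0 : 0 < r := ha0.trans_le hr.1
      have h2 := hUY (r / 2) ⟨by linarith, by linarith [hr.2]⟩
      have h3 := h2.unique hp (by linarith) (h1.mono (show a / 2 ≤ r / 2 by linarith [hr.1]))
      have hrI : r ∈ Icc (r / 2) b := ⟨by linarith, hr.2⟩
      exact ⟨h3.1 hrI, h3.2 hrI⟩
    exact (h1.mono (show a / 2 ≤ a by linarith)).congr ha.2.le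
      (fun r hr => (key r hr).1) (fun r hr => (key r hr).2)
  refine ⟨fun r => U (r / 2) r, fun r => Y (r / 2) r, hshoot, fun r hr => ?_⟩
  have hI : r / 2 ∈ Ioo 0 b := ⟨by linarith [hr.1], by linarith [hr.1, hr.2]⟩
  have h0 := h _ hI (fun r => U (r / 2) r) (fun r => Y (r / 2) r) (hshoot _ hI)
  exact (hshoot _ hI).pos_of_nonneg_left hl hI.1 hη h0 ⟨by linarith [hr.1], hr.2⟩

end Classical

/-! ### Counting the sign changes. -/

theorem theorem1p4 (N : ℕ) (hN : 3 ≤ N) (p b lam : ℝ)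
    (hp : ((N : ℝ) + 2) / ((N : ℝ) - 2) < p) (hb : 0 < b) (hlam : 0 < lam)
    (hball : ∃ u₀ : ℝ → ℝ, IsPositiveBallSolution N p lam b u₀) :
    ∃ a₀ ∈ Set.Ioo 0 b, ∀ a : ℝ, 0 < a → a < a₀ →
      HasAtLeastPositiveAnnulusSolutions 3 N p lam a b := by
  obtain ⟨m, rfl⟩ : ∃ m, N = m + 2 := ⟨N - 2, by omega⟩
  have hm : 0 < m := by omega
  have hm' : (0 : ℝ) < m := by exact_mod_cast hm
  have hpm : ((m : ℝ) + 4) / m < p := by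
    refine lt_of_eq_of_lt ?_ hp
    push_cast
    congr 1 <;> ring
  have hp1 : 1 < p := by
    refine lt_trans ?_ hpm
    rw [lt_div_iff₀ hm']; linarith
  obtain ⟨v, hv⟩ := hball
  obtain ⟨B, hB⟩ := isCompact_Icc.exists_bound_of_continuousOn hv.2.1
  obtain ⟨η₀, z, hent⟩ := hv.exists_isEntire hp1 hlam hb
  have hη₀ := hent.eta_pos hlam hm hb
  obtain ⟨e, he, hsmall⟩ := exists_forall_small_not_entire hpm hlam hm hb hent
    (fun r hr => (le_abs_self _).trans (hB r (Ioo_subset_Icc_self hr)))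
  obtain ⟨η₁, hη₁, hη₁'⟩ := exists_between (lt_min he hη₀)
  -- Otherwise the solutions of flux `η₁` would glue to one on `(0, b)`, excluded since `η₁ < e`.
  -- The point `a₁` serves as `a₀`.
  have hneg : ∃ a₁ ∈ Ioo 0 b, ∃ u y, IsShooting m p lam a₁ b η₁ u y ∧ u a₁ < 0 := by
    by_contra! hcon
    obtain ⟨u, y, huy⟩ := exists_isEntire_of_forall_nonneg hp1 hlam hη₁ hcon
    exact hsmall η₁ u y (hη₁'.trans_le (min_le_left _ _)) huy
  obtain ⟨a₁, ha₁, u₁, y₁, hs₁, hu₁⟩ := hneg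
  refine ⟨a₁, ha₁, fun a ha haa => ?_⟩
  have hab : a < b := haa.trans ha₁.2
  have haI : a ∈ Ioo 0 b := ⟨ha, hab⟩
  obtain ⟨ε, hε, hεpos⟩ := exists_forall_small_pos hp1 hlam ha hab (hent.shoot a haI)
    (hent.flux_neg hlam hm haI)
  obtain ⟨E, hE, hlarge⟩ := exists_forall_large_neg hm hp1 hlam ha hab
  set H : ℝ := max E η₀ + 1 with hH
  have hHE : E < H := by linarith [le_max_left E η₀]
  have hHη : η₀ < H := by linarith [le_max_right E η₀]
  have hη₁₀ : η₁ < η₀ := hη₁'.trans_le (min_le_right _ _)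
  obtain ⟨U, Y, hUY, hUc⟩ := exists_shooting_family m hp1 hlam ha hab (hη₀.trans hHη)
  obtain ⟨η₂, hη₂, hη₂'⟩ := exists_between (lt_min hε hη₁)
  have hη₂₁ : η₂ < η₁ := hη₂'.trans_le (min_le_right _ _)
  have g₂ : 0 < U η₂ a := hεpos η₂ _ _ hη₂ (hη₂'.trans_le (min_le_left _ _))
    (hUY η₂ ⟨hη₂.le, by linarith⟩) fun r hr => hent.pos r ⟨ha.trans_le hr.1, hr.2⟩
  -- A nonnegative value at `a` would make the solution positive at `a₁ > a`.
  have g₁ : U η₁ a < 0 := by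
    by_contra! hcon
    have h1 := hUY η₁ ⟨hη₁.le, by linarith⟩
    have h2 := h1.pos_of_nonneg_left hlam ha hη₁ hcon ⟨haa, ha₁.2⟩
    have h3 := ((h1.mono haa.le).unique hp1 ha₁.1 hs₁).1 ⟨le_rfl, ha₁.2.le⟩
    linarith
  have g₀ : 0 < U η₀ a := by
    have h3 := ((hUY η₀ ⟨hη₀.le, hHη.le⟩).unique hp1 ha (hent.shoot a haI)).1 ⟨le_rfl, hab.le⟩
    rw [h3]
    exact hent.pos a haI
  have gH : U H a < 0 := hlarge H _ _ hHE (hUY H ⟨by linarith, le_rfl⟩)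
  obtain ⟨ζ₁, hζ₁, hz₁⟩ := intermediate_value_Ioo' hη₂₁.le
    (hUc.mono (Icc_subset_Icc hη₂.le (by linarith))) ⟨g₁, g₂⟩
  obtain ⟨ζ₂, hζ₂, hz₂⟩ := intermediate_value_Ioo hη₁₀.le
    (hUc.mono (Icc_subset_Icc hη₁.le hHη.le)) ⟨g₁, g₀⟩
  obtain ⟨ζ₃, hζ₃, hz₃⟩ := intermediate_value_Ioo' hHη.le
    (hUc.mono (Icc_subset_Icc hη₀.le le_rfl)) ⟨gH, g₀⟩
  have h12 : ζ₁ < ζ₂ := hζ₁.2.trans hζ₂.1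
  have h23 : ζ₂ < ζ₃ := hζ₂.2.trans hζ₃.1
  have h3H : ζ₃ ≤ H := hζ₃.2.le
  have hζ0 : 0 < ζ₁ := hη₂.trans hζ₁.1
  set ζ : Fin 3 → ℝ := ![ζ₁, ζ₂, ζ₃] with hζ
  have hζI : ∀ i, 0 < ζ i ∧ ζ i ≤ H ∧ U (ζ i) a = 0 := by
    intro i
    fin_cases i
    · exact ⟨hζ0, (h12.trans h23).le.trans h3H, hz₁⟩
    · exact ⟨hζ0.trans h12, h23.le.trans h3H, hz₂⟩
    · exact ⟨(hζ0.trans h12).trans h23, h3H, hz₃⟩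
  have hinj : StrictMono ζ := by
    rw [Fin.strictMono_iff_lt_succ]
    intro i
    fin_cases i
    · exact h12
    · exact h23
  refine ⟨fun i => U (ζ i), fun i => ?_, fun i j hij hEq => hij (hinj.injective ?_)⟩
  · obtain ⟨h1, h2, h3⟩ := hζI i
    exact (hUY _ ⟨h1.le, h2⟩).isPositiveAnnulusSolution hp1 hlam ha h1 h3
  · exact (hUY _ ⟨(hζI i).1.le, (hζI i).2.1⟩).eta_eq (hUY _ ⟨(hζI j).1.le, (hζI j).2.1⟩)
      ha hab hEq
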